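/- Let $\mathcal A$ be a small $2$-category and $\mathcal C$ a $2$-category with small hom-categories; $2$-categories and $2$-functors are strict, $\mathbf{Cat}$ is the $2$-category of small categories, and $(-)^{\mathrm{op}}$ reverses $1$-cells only. For a $2$-functor $W\colon\mathcal A^{\mathrm{op}}\to\mathbf{Cat}$, the (contravariant) $2$-category of elements $\int W$ has as objects the pairs $(A,X)$ with $A\in\mathcal A$, $X\in W(A)$; as morphisms $(A,X)\to(B,X')$ the pairs $(f,\alpha)$ with $f\colon A\to B$ in $\mathcal A$ and $\alpha\colon X\to W(f)(X')$ in $W(A)$; as $2$-cells $(f,\alpha)\Rightarrow(g,\beta)$ the $2$-cells $\delta\colon f\Rightarrow g$ of $\mathcal A$ with $W(\delta)_{X'}\circ\alpha=\beta$. Let $\pi_W\colon\int W\to\mathcal A$ be the projection. For $2$-functors $M,N\colon(\int W)^{\mathrm{op}}\to\mathcal D$, a cartesian-marked oplax natural transformation $M\to N$ is an oplax natural transformation whose structure $2$-cells on the morphisms $(f,\mathrm{id})$ of $\int W$ are identities. For a $2$-functor $F\colon\int W\to\mathcal C$, the cartesian-marked oplax conical colimit of $F$ is an object $L\in\mathcal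 C$ with isomorphisms of categories, $2$-natural in $U\in\mathcal C$, between $\mathcal C(L,U)$ and the category of cartesian-marked oplax natural transformations $\Delta 1\to\mathcal C(F(-),U)$ and modifications. For $2$-functors $W\colon\mathcal B^{\mathrm{op}}\to\mathbf{Cat}$ and $F\colon\mathcal B\to\mathcal C$ with $\mathcal B$ small, the weighted $2$-colimit $\operatorname{colim}^W F$ is an object $L\in\mathcal C$ with isomorphisms of categories $\mathcal C(L,U)\cong[\mathcal B^{\mathrm{op}},\mathbf{Cat}](W,\mathcal C(F(-),U))$, $2$-natural in $U\in\mathcal C$. 1. Let $W\colon\mathcal A^{\mathrm{op}}\to\mathbf{Cat}$ and $F\colon\mathcal A\to\mathcal C$ be $2$-functors. An object of $\mathcal C$ is (underlies) the weighted $2$-colimit $\operatorname{colim}^W F$ if and only if it is (underlies) the cartesian-marked oplax conical colimit of $F\circ\pi_W$. In particular either colimit exists if the other does, and then they are isomorphic in $\mathcal C$. 2. Let $Z\colon\mathcal A^{\mathrm{op}}\to\mathbf{Cat}$ and $F\colon\int Z\to\mathcal C$ be $2$-functors. Let $V_Z\colon(\int Z)^{\mathrm{op}}\to\mathbf{Cat}$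 be the $2$-functor that sends $(B,X')$ to the coslice $X'/Z(B)$, a morphism $(g,\beta)\colon(B,X')\to(C,X'')$ of $\int Z$ to the functor $X''/Z(C)\to X'/Z(B)$ given by $\gamma\mapsto Z(g)(\gamma)\circ\beta$ on objects and by $Z(g)$ on morphisms, and a $2$-cell $\delta$ to the natural transformation with components $Z(\delta)_{\operatorname{cod}(-)}$. An object of $\mathcal C$ is (underlies) the cartesian-marked oplax conical colimit of $F$ if and only if it is (underlies) the weighted $2$-colimit $\operatorname{colim}^{V_Z}F$. In particular either colimit exists if the other does, and then they are isomorphic in $\mathcal C$. -/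

import Mathlib

open CategoryTheory Bicategory Opposite Bicategory.Opposite
open scoped CategoryTheory.Oplax.OplaxTrans

universe w₁ w₂ v₁ v₂ u₁ u₂ w v u

namespace OplaxColim

/-! Throughout, a `2`-category is a bicategory `B` with `[Bicategory.Strict B]`, a `2`-functor is a
`StrictPseudofunctor`, and `Bᵒᵖ` is the `2`-category obtained by reversing the `1`-cells only. -/

lemma eqToHom_op2 {B : Type u₁} [Bicategory.{w₁, v₁} B] {a b : B} {f g : a ⟶ b} (h : f = g) :
    op2 (eqToHom h) = eqToHom (congrArg Quiver.Hom.op h) := by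
  cases h; rfl

instance opStrict (B : Type u₁) [Bicategory.{w₁, v₁} B] [Bicategory.Strict B] :
    Bicategory.Strict Bᵒᵖ where
  id_comp f := Quiver.Hom.unop_inj (Bicategory.Strict.comp_id f.unop)
  comp_id f := Quiver.Hom.unop_inj (Bicategory.Strict.id_comp f.unop)
  assoc f g h := Quiver.Hom.unop_inj (Bicategory.Strict.assoc h.unop g.unop f.unop).symm
  leftUnitor_eqToIso f := by
    apply Iso.ext
    change op2 (ρ_ f.unop).hom = _
    rw [Bicategory.Strict.rightUnitor_eqToIso]
    exact eqToHom_op2 (Bicategory.Strict.comp_id _)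
  rightUnitor_eqToIso f := by
    apply Iso.ext
    change op2 (λ_ f.unop).hom = _
    rw [Bicategory.Strict.leftUnitor_eqToIso]
    exact eqToHom_op2 (Bicategory.Strict.id_comp _)
  associator_eqToIso f g h := by
    apply Iso.ext
    change op2 (α_ h.unop g.unop f.unop).inv = _
    rw [Bicategory.Strict.associator_eqToIso]
    exact eqToHom_op2 (Bicategory.Strict.assoc _ _ _).symm

/-! ### The contravariant 2-category of elements -/

section Elements

variable {A : Type u₁} [Bicategory.{w₁, v₁} A]

/-- Objects of the `2`-category of elements of `W : Aᵒᵖ → Cat`: pairs `(a, x)` with `x ∈ W(a)`. -/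
structure Elements (W : StrictPseudofunctor Aᵒᵖ Cat.{v, u}) where
  base : A
  fiber : W.obj (op base)

namespace Elements

variable {W : StrictPseudofunctor Aᵒᵖ Cat.{v, u}}

/-- Morphisms `(a, x) ⟶ (b, y)`: pairs `(f, α)` with `f : a ⟶ b` and `α : x ⟶ W(f)(y)`. -/
structure Hom (X Y : Elements W) where
  base : X.base ⟶ Y.base
  fiber : X.fiber ⟶ (W.map base.op).toFunctor.obj Y.fiber

/-- Composition `(f, α) ≫ (g, β) = (f ≫ g, W(f)(β) ∘ α)`; the canonical cells `W.mapId`, `W.mapComp`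
of the `2`-functor `W` are identities (they are `eqToIso` of the functoriality equations). -/
instance : CategoryStruct (Elements W) where
  Hom := Hom
  id X := ⟨𝟙 X.base, (W.mapId (op X.base)).inv.toNatTrans.app X.fiber⟩
  comp {X Y Z} p q := ⟨p.base ≫ q.base,
    p.fiber ≫ (W.map p.base.op).toFunctor.map q.fiber ≫
      (W.mapComp q.base.op p.base.op).inv.toNatTrans.app Z.fiber⟩

/-- `2`-cells `(f, α) ⟶ (g, β)`: `2`-cells `δ : f ⟶ g` of `A` with `W(δ)_y ∘ α = β`. -/
@[ext]
structure Hom₂ {X Y : Elements W} (p q : X ⟶ Y) where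
  cell : p.base ⟶ q.base
  w : p.fiber ≫ (W.map₂ (op2 cell)).toNatTrans.app Y.fiber = q.fiber

instance homCategory (X Y : Elements W) : Category (X ⟶ Y) where
  Hom p q := Hom₂ p q
  id p := ⟨𝟙 p.base, by simp⟩
  comp η θ := ⟨η.cell ≫ θ.cell, by
    rw [op2_comp, W.map₂_comp, Cat.Hom₂.comp_app, ← Category.assoc, η.w, θ.w]⟩
  id_comp _ := Hom₂.ext (Category.id_comp _)
  comp_id _ := Hom₂.ext (Category.comp_id _)
  assoc _ _ _ := Hom₂.ext (Category.assoc _ _ _)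

@[simp] lemma id_cell {X Y : Elements W} (p : X ⟶ Y) : Hom₂.cell (𝟙 p) = 𝟙 p.base := rfl
@[simp] lemma comp_cell {X Y : Elements W} {p q r : X ⟶ Y} (η : p ⟶ q) (θ : q ⟶ r) :
  Hom₂.cell (η ≫ θ) = η.cell ≫ θ.cell := rfl
@[simp] lemma id_base (X : Elements W) : Hom.base (𝟙 X) = 𝟙 X.base := rfl
@[simp] lemma comp_base {X Y Z : Elements W} (p : X ⟶ Y) (q : Y ⟶ Z) :
  Hom.base (p ≫ q) = p.base ≫ q.base := rfl


/-- An invertible `2`-cell of `A` compatible with the fibre components. -/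
def isoMk {X Y : Elements W} {p q : X ⟶ Y} (e : p.base ≅ q.base)
    (w : p.fiber ≫ (W.map₂ (op2 e.hom)).toNatTrans.app Y.fiber = q.fiber) : p ≅ q where
  hom := (⟨e.hom, w⟩ : Hom₂ p q)
  inv := (⟨e.inv, by
    rw [← w, Category.assoc, ← Cat.Hom₂.comp_app, ← W.map₂_comp, ← op2_comp, e.hom_inv_id]
    simp⟩ : Hom₂ q p)
  hom_inv_id := Hom₂.ext e.hom_inv_id
  inv_hom_id := Hom₂.ext e.inv_hom_id

/-- Whiskering and the structure isomorphisms are inherited from `A`. -/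
instance : Bicategory (Elements W) where
  homCategory := homCategory
  whiskerLeft {X Y Z} p q r η := (⟨p.base ◁ η.cell, by
    have h := η.w
    change (p.fiber ≫ (W.map p.base.op).toFunctor.map q.fiber ≫
      (W.mapComp q.base.op p.base.op).inv.toNatTrans.app Z.fiber) ≫
      (W.map₂ (op2 η.cell ▷ p.base.op)).toNatTrans.app Z.fiber =
      p.fiber ≫ (W.map p.base.op).toFunctor.map r.fiber ≫
      (W.mapComp r.base.op p.base.op).inv.toNatTrans.app Z.fiber
    rw [W.map₂_whisker_right, ← h]
    simp⟩ : Hom₂ (p ≫ q) (p ≫ r))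
  whiskerRight {X Y Z} p q η r := (⟨η.cell ▷ r.base, by
    have h := η.w
    change (p.fiber ≫ (W.map p.base.op).toFunctor.map r.fiber ≫
      (W.mapComp r.base.op p.base.op).inv.toNatTrans.app Z.fiber) ≫
      (W.map₂ (r.base.op ◁ op2 η.cell)).toNatTrans.app Z.fiber =
      q.fiber ≫ (W.map q.base.op).toFunctor.map r.fiber ≫
      (W.mapComp r.base.op q.base.op).inv.toNatTrans.app Z.fiber
    rw [W.map₂_whisker_left, ← h]
    simp⟩ : Hom₂ (p ≫ r) (q ≫ r))
  associator {_ _ _ Z} p q r := (isoMk (p := p ≫ q ≫ r) (q := (p ≫ q) ≫ r)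
      (α_ p.base q.base r.base).symm (by
    change (p.fiber ≫ (W.map p.base.op).toFunctor.map (q.fiber ≫
        (W.map q.base.op).toFunctor.map r.fiber ≫
          (W.mapComp r.base.op q.base.op).inv.toNatTrans.app Z.fiber) ≫
        (W.mapComp (r.base.op ≫ q.base.op) p.base.op).inv.toNatTrans.app Z.fiber) ≫
        (W.map₂ (α_ r.base.op q.base.op p.base.op).hom).toNatTrans.app Z.fiber =
      (p.fiber ≫ (W.map p.base.op).toFunctor.map q.fiber ≫
          (W.mapComp q.base.op p.base.op).inv.toNatTrans.app _) ≫
        (W.map (q.base.op ≫ p.base.op)).toFunctor.map r.fiber ≫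
          (W.mapComp r.base.op (q.base.op ≫ p.base.op)).inv.toNatTrans.app Z.fiber
    rw [W.map₂_associator]
    have h := (W.mapComp q.base.op p.base.op).inv.toNatTrans.naturality r.fiber
    have h' := congrArg (W.map p.base.op).toFunctor.map
      (Cat.Hom.inv_hom_id_toNatTrans_app (W.mapComp r.base.op q.base.op) Z.fiber)
    rw [Functor.map_comp] at h'
    simp only [Category.assoc]
    rw [← reassoc_of% h]
    simp [reassoc_of% h'])).symm
  leftUnitor {X Y} p := isoMk (p := 𝟙 X ≫ p) (q := p) (λ_ p.base) (by
    change ((W.mapId (op X.base)).inv.toNatTrans.app X.fiber ≫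
        (W.map (𝟙 (op X.base))).toFunctor.map p.fiber ≫
        (W.mapComp p.base.op (𝟙 (op X.base))).inv.toNatTrans.app Y.fiber) ≫
        (W.map₂ (ρ_ p.base.op).hom).toNatTrans.app Y.fiber = p.fiber
    rw [W.map₂_right_unitor]
    simp)
  rightUnitor {X Y} p := isoMk (p := p ≫ 𝟙 Y) (q := p) (ρ_ p.base) (by
    change (p.fiber ≫ (W.map p.base.op).toFunctor.map
        ((W.mapId (op Y.base)).inv.toNatTrans.app Y.fiber) ≫
        (W.mapComp (𝟙 (op Y.base)) p.base.op).inv.toNatTrans.app Y.fiber) ≫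
        (W.map₂ (λ_ p.base.op).hom).toNatTrans.app Y.fiber = p.fiber
    rw [W.map₂_left_unitor]
    have h' := Cat.Hom.inv_hom_id_toNatTrans_app (W.mapId (op Y.base)) Y.fiber
    simp [← Functor.map_comp, h'])
  whiskerLeft_id _ _ := Hom₂.ext (Bicategory.whiskerLeft_id _ _)
  whiskerLeft_comp _ _ _ _ _ _ := Hom₂.ext (Bicategory.whiskerLeft_comp _ _ _)
  id_whiskerLeft _ := Hom₂.ext (Bicategory.id_whiskerLeft _)
  comp_whiskerLeft _ _ _ _ _ := Hom₂.ext (Bicategory.comp_whiskerLeft _ _ _)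
  id_whiskerRight _ _ := Hom₂.ext (Bicategory.id_whiskerRight _ _)
  comp_whiskerRight _ _ _ := Hom₂.ext (Bicategory.comp_whiskerRight _ _ _)
  whiskerRight_id _ := Hom₂.ext (Bicategory.whiskerRight_id _)
  whiskerRight_comp _ _ _ := Hom₂.ext (Bicategory.whiskerRight_comp _ _ _)
  whisker_assoc _ _ _ _ _ := Hom₂.ext (Bicategory.whisker_assoc _ _ _)
  whisker_exchange _ _ := Hom₂.ext (Bicategory.whisker_exchange _ _)
  pentagon _ _ _ _ := Hom₂.ext (Bicategory.pentagon _ _ _ _)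
  triangle _ _ := Hom₂.ext (Bicategory.triangle _ _)

lemma eq_of_cell {X Y : Elements W} {p q : X ⟶ Y} (η : p ⟶ q) (h : p.base = q.base)
    (hη : Hom₂.cell η = eqToHom h) : p = q := by
  obtain ⟨f, α⟩ := p
  obtain ⟨g, β⟩ := q
  obtain ⟨δ, w⟩ := η
  obtain rfl : f = g := h
  obtain rfl : δ = 𝟙 f := hη
  obtain rfl : α = β := by simpa using w
  rfl

lemma eqToHom_cell {X Y : Elements W} {p q : X ⟶ Y} (h : p = q) :
    Hom₂.cell (eqToHom h) = eqToHom (congrArg Hom.base h) := by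
  cases h; rfl

lemma eqToIso_of_cell {X Y : Elements W} {p q : X ⟶ Y} (e : p ≅ q) (h : p = q)
    (h' : p.base = q.base) (he : Hom₂.cell e.hom = eqToHom h') : e = eqToIso h :=
  Iso.ext (Hom₂.ext (he.trans (eqToHom_cell h).symm))

lemma leftUnitor_cell [Bicategory.Strict A] {X Y : Elements W} (p : X ⟶ Y) :
    Hom₂.cell (λ_ p).hom = eqToHom (Bicategory.Strict.id_comp p.base) :=
  congrArg Iso.hom (Bicategory.Strict.leftUnitor_eqToIso p.base)

lemma rightUnitor_cell [Bicategory.Strict A] {X Y : Elements W} (p : X ⟶ Y) :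
    Hom₂.cell (ρ_ p).hom = eqToHom (Bicategory.Strict.comp_id p.base) :=
  congrArg Iso.hom (Bicategory.Strict.rightUnitor_eqToIso p.base)

lemma associator_cell [Bicategory.Strict A] {X Y Z T : Elements W} (p : X ⟶ Y) (q : Y ⟶ Z)
    (r : Z ⟶ T) :
    Hom₂.cell (α_ p q r).hom = eqToHom (Bicategory.Strict.assoc p.base q.base r.base) :=
  congrArg Iso.hom (Bicategory.Strict.associator_eqToIso p.base q.base r.base)

instance [Bicategory.Strict A] : Bicategory.Strict (Elements W) where
  id_comp p := eq_of_cell _ _ (leftUnitor_cell p)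
  comp_id p := eq_of_cell _ _ (rightUnitor_cell p)
  assoc p q r := eq_of_cell _ _ (associator_cell p q r)
  leftUnitor_eqToIso p := eqToIso_of_cell _ _ _ (leftUnitor_cell p)
  rightUnitor_eqToIso p := eqToIso_of_cell _ _ _ (rightUnitor_cell p)
  associator_eqToIso p q r := eqToIso_of_cell _ _ _ (associator_cell p q r)

variable (W) in
/-- The projection `∫W → A`. -/
def proj [Bicategory.Strict A] : StrictPseudofunctor (Elements W) A :=
  StrictPseudofunctor.mk''
    { obj := fun X => X.base
      map := fun p => p.base
      map₂ := fun η => Hom₂.cell η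
      map₂_whisker_left := fun {_ _ _} p {_ _} η => by
        simp only [eqToHom_refl, Category.id_comp, Category.comp_id]; rfl
      map₂_whisker_right := fun {_ _ _ _ _} η p => by
        simp only [eqToHom_refl, Category.id_comp, Category.comp_id]; rfl }

end Elements
end Elements

/-! ### Marked oplax natural transformations -/

section Marked

/-- A `2`-cell that is an identity (its source and target being equal). -/
def IsIdCell {D : Type u₂} [Bicategory.{w₂, v₂} D] {a b : D} {f g : a ⟶ b} (η : f ⟶ g) : Prop :=
  ∃ h : f = g, η = eqToHom h

/-- The oplax functor underlying a `2`-functor. -/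
abbrev oplax {B : Type u₁} [Bicategory.{w₁, v₁} B] {D : Type u₂} [Bicategory.{w₂, v₂} D]
    (M : StrictPseudofunctor B D) : B ⥤ᵒᵖᴸ D :=
  M.toPseudofunctor.toOplax

variable {B : Type u₁} [Bicategory.{w₁, v₁} B] {D : Type u₂} [Bicategory.{w₂, v₂} D]

/-- An oplax natural transformation `σ : M ⟶ N` has structure `2`-cells
`σ.naturality f : M.map f ≫ σ.app b ⟶ σ.app a ≫ N.map f`; it is marked with respect to a class `S`
of morphisms if these are identities for all `f` in `S`. -/
def IsMarked (S : MorphismProperty B) (M N : StrictPseudofunctor B D) :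
    ObjectProperty (oplax M ⟶ oplax N) :=
  fun σ => ∀ ⦃a b : B⦄ (f : a ⟶ b), S f → IsIdCell (σ.naturality f)

/-- The category of `S`-marked oplax natural transformations `M ⟶ N` and modifications. -/
abbrev MarkedTrans (S : MorphismProperty B) (M N : StrictPseudofunctor B D) :=
  (IsMarked S M N).FullSubcategory

end Marked

lemma IsIdCell.comp {D : Type u₂} [Bicategory.{w₂, v₂} D] {a b : D} {f g h : a ⟶ b}
    {η : f ⟶ g} {θ : g ⟶ h} (hη : IsIdCell η) (hθ : IsIdCell θ) : IsIdCell (η ≫ θ) := by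
  obtain ⟨rfl, rfl⟩ := hη
  obtain ⟨rfl, rfl⟩ := hθ
  exact ⟨rfl, by simp⟩

lemma IsIdCell.whiskerLeft {D : Type u₂} [Bicategory.{w₂, v₂} D] {a b c : D} (k : a ⟶ b)
    {f g : b ⟶ c} {η : f ⟶ g} (hη : IsIdCell η) : IsIdCell (k ◁ η) := by
  obtain ⟨rfl, rfl⟩ := hη
  exact ⟨rfl, by simp⟩

lemma IsIdCell.whiskerRight {D : Type u₂} [Bicategory.{w₂, v₂} D] {a b c : D}
    {f g : a ⟶ b} {η : f ⟶ g} (hη : IsIdCell η) (k : b ⟶ c) : IsIdCell (η ▷ k) := by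
  obtain ⟨rfl, rfl⟩ := hη
  exact ⟨rfl, by simp⟩

lemma IsIdCell.associator {D : Type u₂} [Bicategory.{w₂, v₂} D] [Bicategory.Strict D] {a b c d : D}
    (f : a ⟶ b) (g : b ⟶ c) (h : c ⟶ d) : IsIdCell (α_ f g h).hom :=
  ⟨Bicategory.Strict.assoc f g h, by rw [Bicategory.Strict.associator_eqToIso]; rfl⟩

lemma IsIdCell.associator_inv {D : Type u₂} [Bicategory.{w₂, v₂} D] [Bicategory.Strict D]
    {a b c d : D} (f : a ⟶ b) (g : b ⟶ c) (h : c ⟶ d) : IsIdCell (α_ f g h).inv :=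
  ⟨(Bicategory.Strict.assoc f g h).symm, by rw [Bicategory.Strict.associator_eqToIso]; rfl⟩

lemma IsIdCell.leftUnitor {D : Type u₂} [Bicategory.{w₂, v₂} D] [Bicategory.Strict D]
    {a b : D} (f : a ⟶ b) : IsIdCell (λ_ f).hom :=
  ⟨Bicategory.Strict.id_comp f, by rw [Bicategory.Strict.leftUnitor_eqToIso]; rfl⟩

lemma IsIdCell.rightUnitor_inv {D : Type u₂} [Bicategory.{w₂, v₂} D] [Bicategory.Strict D]
    {a b : D} (f : a ⟶ b) : IsIdCell (ρ_ f).inv :=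
  ⟨(Bicategory.Strict.comp_id f).symm, by rw [Bicategory.Strict.rightUnitor_eqToIso]; rfl⟩

lemma IsIdCell.of_eq {D : Type u₂} [Bicategory.{w₂, v₂} D] {a b : D} {f g : a ⟶ b} {e : f ≅ g}
    {h : f = g} (he : e = eqToIso h) : IsIdCell e.hom :=
  ⟨h, congrArg Iso.hom he⟩

lemma IsIdCell.unique {D : Type u₂} [Bicategory.{w₂, v₂} D] {a b : D} {f g : a ⟶ b}
    {η θ : f ⟶ g} (hη : IsIdCell η) (hθ : IsIdCell θ) : η = θ := by
  obtain ⟨_, rfl⟩ := hη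
  obtain ⟨_, rfl⟩ := hθ
  rfl

lemma IsIdCell.of_app {P Q : Cat.{v, u}} {F G : P ⟶ Q} (η : F ⟶ G)
    (h : ∀ x : P, ∃ e : F.toFunctor.obj x = G.toFunctor.obj x, η.toNatTrans.app x = eqToHom e) :
    IsIdCell η := by
  choose e he using h
  have hFG : F = G := Cat.ext (CategoryTheory.Functor.ext e fun x y f => by
    have := η.toNatTrans.naturality f
    rw [he, he] at this
    rw [← reassoc_of% this]
    simp)
  exact ⟨hFG, Cat.Hom₂.ext (NatTrans.ext (funext fun x => by rw [he, Cat.eqToHom_app]))⟩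

lemma whiskerLeft_congr {D : Type u₂} [Bicategory.{w₂, v₂} D] {a b c : D} {k l : a ⟶ b} (h : k = l)
    {f g : b ⟶ c} (η : f ⟶ g) :
    k ◁ η = eqToHom (congrArg (· ≫ f) h) ≫ l ◁ η ≫ eqToHom (congrArg (· ≫ g) h.symm) := by
  cases h; simp

lemma conj_app {P Q : Cat.{v, u}} {F F' G G' : P ⟶ Q} (h : F = F') (η : F' ⟶ G') (h' : G' = G)
    (x : P) : (eqToHom h ≫ η ≫ eqToHom h').toNatTrans.app x =
      eqToHom (by rw [h]) ≫ η.toNatTrans.app x ≫ eqToHom (by rw [h']) := by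
  cases h; cases h'; simp

lemma isIdCell_associatorMiddle {D : Type u₂} [Bicategory.{w₂, v₂} D] [Bicategory.Strict D]
    {a b c d : D} (f : a ⟶ b) (h : c ⟶ d) :
    IsIdCell (associatorNatIsoMiddleCat f h).hom :=
  .of_app _ fun (x : b ⟶ c) => IsIdCell.associator f x h

/-! ### The presheaves `C(F(-), U)` -/

section HomInto

lemma map₂_whiskerRight_whiskerRight {B : Type u₁} [Bicategory.{w₁, v₁} B]
    {C : Type u₂} [Bicategory.{w₂, v₂} C] [Bicategory.Strict C] (F : StrictPseudofunctor B C)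
    {a b c : B} {f g : a ⟶ b} (η : f ⟶ g) (h : b ⟶ c) {U : C} (x : F.obj c ⟶ U) :
    F.map₂ (η ▷ h) ▷ x =
      eqToHom (by rw [F.map_comp, Bicategory.Strict.assoc]) ≫
        F.map₂ η ▷ (F.map h ≫ x) ≫
        eqToHom (by rw [F.map_comp, Bicategory.Strict.assoc]) := by
  rw [F.map₂_whisker_right]
  simp [Bicategory.Strict.associator_eqToIso, F.mapComp_eq_eqToIso]

lemma map₂_whiskerLeft_whiskerRight {B : Type u₁} [Bicategory.{w₁, v₁} B]
    {C : Type u₂} [Bicategory.{w₂, v₂} C] [Bicategory.Strict C] (F : StrictPseudofunctor B C)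
    {a b c : B} (h : a ⟶ b) {f g : b ⟶ c} (η : f ⟶ g) {U : C} (x : F.obj c ⟶ U) :
    F.map₂ (h ◁ η) ▷ x =
      eqToHom (by rw [F.map_comp, Bicategory.Strict.assoc]) ≫
        F.map h ◁ (F.map₂ η ▷ x) ≫
        eqToHom (by rw [F.map_comp, Bicategory.Strict.assoc]) := by
  rw [F.map₂_whisker_left]
  simp [Bicategory.Strict.associator_eqToIso, F.mapComp_eq_eqToIso]

variable {B : Type u₁} [Bicategory.{w₁, v₁} B] [Bicategory.Strict B]
  {C : Type u₂} [Bicategory.{w, v} C] [Bicategory.Strict C]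

/-- The `2`-functor `C(F(-), U) : Bᵒᵖ → Cat`. -/
def homInto (F : StrictPseudofunctor B C) (U : C) : StrictPseudofunctor Bᵒᵖ Cat.{w, v} :=
  StrictPseudofunctor.mk''
    { obj := fun b => Cat.of (F.obj b.unop ⟶ U)
      map := fun f => (precomposingCat _ _ U).obj (F.map f.unop)
      map₂ := fun η => (precomposingCat _ _ U).map (F.map₂ η.unop2)
      map₂_id := fun f => by
        change (precomposingCat _ _ U).map (F.map₂ (𝟙 f.unop)) = _
        rw [F.map₂_id]
        exact (precomposingCat _ _ U).map_id _
      map₂_comp := fun η θ => by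
        change (precomposingCat _ _ U).map (F.map₂ (η.unop2 ≫ θ.unop2)) = _
        rw [F.map₂_comp]
        exact (precomposingCat _ _ U).map_comp _ _
      map_id := fun b => by
        refine Cat.ext (CategoryTheory.Functor.ext (fun x => ?_)
          (fun (x y : F.obj b.unop ⟶ U) (η : x ⟶ y) => ?_))
        · change F.map (𝟙 b.unop) ≫ x = x
          rw [F.map_id]
          exact Bicategory.Strict.id_comp _
        · change F.map (𝟙 b.unop) ◁ η = eqToHom _ ≫ η ≫ eqToHom _
          rw [whiskerLeft_congr (F.map_id _), Bicategory.id_whiskerLeft]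
          simp [Bicategory.Strict.leftUnitor_eqToIso]
      map_comp := fun f g => by
        refine Cat.ext (CategoryTheory.Functor.ext (fun x => ?_)
          (fun (x y : F.obj _ ⟶ U) (η : x ⟶ y) => ?_))
        · change F.map (g.unop ≫ f.unop) ≫ x = F.map g.unop ≫ F.map f.unop ≫ x
          rw [F.map_comp]
          exact Bicategory.Strict.assoc _ _ _
        · change F.map (g.unop ≫ f.unop) ◁ η =
            eqToHom _ ≫ F.map g.unop ◁ F.map f.unop ◁ η ≫ eqToHom _
          rw [whiskerLeft_congr (F.map_comp _ _), Bicategory.comp_whiskerLeft]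
          simp [Bicategory.Strict.associator_eqToIso]
      map₂_whisker_left := fun f g h η => by
        refine Cat.Hom₂.ext (NatTrans.ext (funext fun (x : F.obj (unop _) ⟶ U) => ?_))
        erw [conj_app]
        exact map₂_whiskerRight_whiskerRight F η.unop2 f.unop x
      map₂_whisker_right := fun {a b c f g} η h => by
        refine Cat.Hom₂.ext (NatTrans.ext (funext fun (x : F.obj (unop _) ⟶ U) => ?_))
        erw [conj_app]
        exact map₂_whiskerLeft_whiskerRight F h.unop η.unop2 x }

/-- Postcomposition with `k : U ⟶ V`, the `2`-natural transformation `C(F(-), U) → C(F(-), V)`. -/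
def homIntoMap (F : StrictPseudofunctor B C) {U V : C} (k : U ⟶ V) :
    oplax (homInto F U) ⟶ oplax (homInto F V) :=
  Oplax.OplaxTrans.mk (fun b => (postcomposingCat (F.obj b.unop) U V).obj k)
    (fun f => (associatorNatIsoMiddleCat (F.map f.unop) k).hom)
    (fun {a b f g} η => by
      refine Cat.Hom₂.ext (NatTrans.ext (funext fun (x : F.obj (unop _) ⟶ U) => ?_))
      change (F.map₂ η.unop2 ▷ x) ▷ k ≫ (α_ (F.map g.unop) x k).hom =
        (α_ (F.map f.unop) x k).hom ≫ F.map₂ η.unop2 ▷ (x ≫ k)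
      simp)
    (fun b => IsIdCell.unique
      (.comp (isIdCell_associatorMiddle _ _)
        (.whiskerLeft _ (.of_eq ((homInto F V).mapId_eq_eqToIso b))))
      (.comp (.whiskerRight (.of_eq ((homInto F U).mapId_eq_eqToIso b)) _)
        (.comp (.leftUnitor _) (.rightUnitor_inv _))))
    (fun f g => IsIdCell.unique
      (.comp (isIdCell_associatorMiddle _ _)
        (.whiskerLeft _ (.of_eq ((homInto F V).mapComp_eq_eqToIso f g))))
      (.comp (.whiskerRight (.of_eq ((homInto F U).mapComp_eq_eqToIso f g)) _)
        (.comp (.associator _ _ _) (.comp (.whiskerLeft _ (isIdCell_associatorMiddle _ _))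
          (.comp (.associator_inv _ _ _)
            (.comp (.whiskerRight (isIdCell_associatorMiddle _ _) _) (.associator _ _ _)))))))

/-- Postcomposition with a `2`-cell `κ : k ⟶ l`. -/
def homIntoMap₂ (F : StrictPseudofunctor B C) {U V : C} {k l : U ⟶ V} (κ : k ⟶ l) :
    homIntoMap F k ⟶ homIntoMap F l :=
  ⟨⟨fun b => (postcomposingCat (F.obj b.unop) U V).map κ, fun {a b} f => by
    refine Cat.Hom₂.ext (NatTrans.ext (funext fun (x : F.obj (unop _) ⟶ U) => ?_))
    change (F.map f.unop ≫ x) ◁ κ ≫ (α_ (F.map f.unop) x l).hom =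
      (α_ (F.map f.unop) x k).hom ≫ F.map f.unop ◁ (x ◁ κ)
    simp⟩⟩

end HomInto

/-! ### Marked weighted colimits -/

section Colimits

variable {B : Type u} [Bicategory.{u, u} B] [Bicategory.Strict B]
  {C : Type u₁} [Bicategory.{u, u} C] [Bicategory.Strict C]
  (S : MorphismProperty Bᵒᵖ) (W : StrictPseudofunctor Bᵒᵖ Cat.{u, u}) (F : StrictPseudofunctor B C)

/-- The category of `S`-marked oplax natural transformations `W ⟶ C(F(-), U)` and modifications. -/
abbrev Cocones (U : C) := MarkedTrans S W (homInto F U)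

/-- Action of `Cocones S W F` on a `1`-cell: postcompose every component with `k`. -/
def coconesMap {U V : C} (k : U ⟶ V) : Cocones S W F U ⥤ Cocones S W F V where
  obj σ := ⟨σ.obj ≫ homIntoMap F k, fun _ _ f hf =>
    .comp (.associator_inv _ _ _) (.comp (.whiskerRight (σ.property f hf) _)
      (.comp (.associator _ _ _) (.comp (.whiskerLeft _ (isIdCell_associatorMiddle _ _))
        (.associator_inv _ _ _))))⟩
  map Γ := ObjectProperty.homMk (Oplax.OplaxTrans.whiskerRight Γ.hom (homIntoMap F k))
  map_id σ := ObjectProperty.hom_ext _ (Oplax.OplaxTrans.homCategory.ext fun _ =>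
    Bicategory.id_whiskerRight _ _)
  map_comp Γ Θ := ObjectProperty.hom_ext _ (Oplax.OplaxTrans.homCategory.ext fun _ =>
    Bicategory.comp_whiskerRight _ _ _)

/-- Action of `Cocones S W F` on a `2`-cell. -/
def coconesMap₂ {U V : C} {k l : U ⟶ V} (κ : k ⟶ l) :
    coconesMap S W F k ⟶ coconesMap S W F l where
  app σ := ObjectProperty.homMk (Oplax.OplaxTrans.whiskerLeft σ.obj (homIntoMap₂ F κ))
  naturality σ τ Γ := ObjectProperty.hom_ext _ (Oplax.OplaxTrans.homCategory.ext fun _ =>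
    (Bicategory.whisker_exchange _ _).symm)

/-- `L` together with isomorphisms of categories `C(L, U) ≅ Cocones S W F U`, `2`-natural in `U`. -/
structure ColimitData (L : C) where
  iso (U : C) : Cat.of (L ⟶ U) ≅ Cat.of (Cocones S W F U)
  naturality {U V : C} (k : U ⟶ V) :
    (postcomposingCat L U V).obj k ≫ (iso V).hom = (iso U).hom ≫ (coconesMap S W F k).toCatHom
  naturality₂ {U V : C} {k l : U ⟶ V} (κ : k ⟶ l) :
    (postcomposingCat L U V).map κ ▷ (iso V).hom =
      eqToHom (naturality k) ≫ (iso U).hom ◁ (coconesMap₂ S W F κ).toCatHom₂ ≫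
        eqToHom (naturality l).symm

/-- `L` is the `2`-colimit of `F` weighted by `W`. The category `[Bᵒᵖ, Cat](W, C(F(-), U))` has as
objects the `2`-natural transformations, i.e. the oplax natural transformations all of whose
structure `2`-cells are identities, and as morphisms the modifications. -/
def IsWeightedColimit (L : C) : Prop :=
  Nonempty (ColimitData ⊤ W F L)

end Colimits

/-! ### Cartesian-marked oplax conical colimits -/

section Conical

variable {A : Type u} [Bicategory.{u, u} A] [Bicategory.Strict A]

/-- The chosen cartesian morphisms of `∫W`, as morphisms of `(∫W)ᵒᵖ`: those of the form
`(f, id) : (a, W(f)(y)) ⟶ (b, y)`. -/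
def cartesianMarking (W : StrictPseudofunctor Aᵒᵖ Cat.{u, u}) : MorphismProperty (Elements W)ᵒᵖ :=
  fun Y X p => ∃ h : X.unop.fiber = (W.map p.unop.base.op).toFunctor.obj Y.unop.fiber,
    p.unop.fiber = eqToHom h

/-- The `2`-functor constant at the terminal category. -/
def constOne (B : Type u₁) [Bicategory.{w₁, v₁} B] [Bicategory.Strict B] :
    StrictPseudofunctor B Cat.{u, u} :=
  StrictPseudofunctor.mk''
    { obj := fun _ => Cat.of (Discrete PUnit.{u + 1})
      map := fun _ => 𝟙 _
      map₂ := fun _ => 𝟙 _ }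

/-- `L` is the cartesian-marked oplax conical colimit of `F : ∫W → C`. -/
def IsOplaxConicalColimit {C : Type u₁} [Bicategory.{u, u} C] [Bicategory.Strict C]
    {W : StrictPseudofunctor Aᵒᵖ Cat.{u, u}} (F : StrictPseudofunctor (Elements W) C) (L : C) :
    Prop :=
  Nonempty (ColimitData (cartesianMarking W) (constOne _) F L)

end Conical

/-! ### The weight for cartesian-marked oplax conical colimits -/

section Weight

variable {A : Type u} [Bicategory.{u, u} A] [Bicategory.Strict A]

/-- For `(g, β) : (b, x) ⟶ (c, y)` in `∫Z`, the functor `y / Z(c) ⥤ x / Z(b)` sending `γ : y ⟶ t` to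
`Z(g)(γ) ∘ β : x ⟶ Z(g)(t)` and acting on morphisms by `Z(g)`. -/
def cosliceMap {Z : StrictPseudofunctor Aᵒᵖ Cat.{u, u}} {X Y : Elements Z} (p : X ⟶ Y) :
    Under Y.fiber ⥤ Under X.fiber where
  obj T := Under.mk (p.fiber ≫ (Z.map p.base.op).toFunctor.map T.hom)
  map {T T'} t := Under.homMk ((Z.map p.base.op).toFunctor.map t.right) (by
    simp [← Functor.map_comp])

/-- On `2`-cells, the component at `γ : y ⟶ t` is `Z(δ)_t`. -/
def cosliceMap₂ {Z : StrictPseudofunctor Aᵒᵖ Cat.{u, u}} {X Y : Elements Z} {p q : X ⟶ Y}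
    (δ : p ⟶ q) : cosliceMap p ⟶ cosliceMap q where
  app T := Under.homMk ((Z.map₂ (op2 (Elements.Hom₂.cell δ))).toNatTrans.app T.right) (by
    have h := (Z.map₂ (op2 (Elements.Hom₂.cell δ))).toNatTrans.naturality T.hom
    have hw := Elements.Hom₂.w δ
    change (p.fiber ≫ (Z.map p.base.op).toFunctor.map T.hom) ≫ _ =
      q.fiber ≫ (Z.map q.base.op).toFunctor.map T.hom
    rw [← hw, Category.assoc, Category.assoc]
    exact congrArg _ h)
  naturality T T' t := Under.UnderMorphism.ext
    ((Z.map₂ (op2 (Elements.Hom₂.cell δ))).toNatTrans.naturality t.right)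

lemma under_eqToHom_right {X : Type u} [Category.{u} X] {x : X} {T T' : Under x} (h : T = T') :
    (eqToHom h).right = eqToHom (congrArg (fun T : Under x => T.right) h) := by
  cases h; rfl

lemma under_ext {X : Type u} [Category.{u} X] {x : X} (V V' : Under x) (h : V.right = V'.right)
    (hhom : V.hom ≫ eqToHom h = V'.hom) : V = V' := by
  obtain ⟨⟨⟨⟩⟩, r, f⟩ := V
  obtain ⟨⟨⟨⟩⟩, r', f'⟩ := V'
  obtain rfl : r = r' := h
  obtain rfl : f = f' := by simpa using hhom
  rfl

lemma under_functor_ext {P X : Type u} [Category.{u} P] [Category.{u} X] {x : X}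
    {G G' : P ⥤ Under x} (h : ∀ T, (G.obj T).right = (G'.obj T).right)
    (hhom : ∀ T, (G.obj T).hom ≫ eqToHom (h T) = (G'.obj T).hom)
    (hmap : ∀ {T T'} (t : T ⟶ T'), (G.map t).right ≫ eqToHom (h T') =
      eqToHom (h T) ≫ (G'.map t).right) : G = G' := by
  refine CategoryTheory.Functor.ext (fun T => under_ext _ _ (h T) (hhom T))
    fun T T' t => Under.UnderMorphism.ext ?_
  rw [Under.comp_right, Under.comp_right, under_eqToHom_right, under_eqToHom_right,
    ← reassoc_of% hmap t]
  simp

section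

variable {B : Type u} [Bicategory.{u, u} B] (Z : StrictPseudofunctor B Cat.{u, u})

lemma mapId_hom_app (b : B) (y : Z.obj b) : (Z.mapId b).hom.toNatTrans.app y =
      eqToHom (congrArg (fun k : Z.obj b ⟶ Z.obj b => k.toFunctor.obj y) (Z.map_id b)) := by
  rw [Z.mapId_eq_eqToIso]
  exact Cat.eqToHom_app _ _ (Z.map_id b) _

lemma mapComp_hom_app {a b c : B} (f : a ⟶ b) (g : b ⟶ c) (y : Z.obj a) :
    (Z.mapComp f g).hom.toNatTrans.app y =
      eqToHom (congrArg (fun k : Z.obj a ⟶ Z.obj c => k.toFunctor.obj y) (Z.map_comp f g)) := by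
  rw [Z.mapComp_eq_eqToIso]
  exact Cat.eqToHom_app _ _ (Z.map_comp f g) _

lemma mapComp_inv_app {a b c : B} (f : a ⟶ b) (g : b ⟶ c) (y : Z.obj a) :
    (Z.mapComp f g).inv.toNatTrans.app y =
      eqToHom (congrArg (fun k : Z.obj a ⟶ Z.obj c => k.toFunctor.obj y) (Z.map_comp f g).symm) := by
  rw [Z.mapComp_eq_eqToIso]
  exact Cat.eqToHom_app _ _ (Z.map_comp f g).symm _

lemma map₂_whiskerLeft_app {a b c : B} (f : a ⟶ b) {g h : b ⟶ c} (η : g ⟶ h) (y : Z.obj a) :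
    (Z.map₂ (f ◁ η)).toNatTrans.app y =
      eqToHom (congrArg (fun k : Z.obj a ⟶ Z.obj c => k.toFunctor.obj y) (Z.map_comp f g)) ≫
        (Z.map₂ η).toNatTrans.app ((Z.map f).toFunctor.obj y) ≫
      eqToHom (congrArg (fun k : Z.obj a ⟶ Z.obj c => k.toFunctor.obj y)
        (Z.map_comp f h).symm) := by
  rw [Z.map₂_whisker_left, Cat.Hom₂.comp_app, Cat.Hom₂.comp_app, mapComp_hom_app,
    mapComp_inv_app, Cat.whiskerLeft_app]

lemma map₂_whiskerRight_app {a b c : B} {f g : a ⟶ b} (η : f ⟶ g) (h : b ⟶ c) (y : Z.obj a) :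
    (Z.map₂ (η ▷ h)).toNatTrans.app y =
      eqToHom (congrArg (fun k : Z.obj a ⟶ Z.obj c => k.toFunctor.obj y) (Z.map_comp f h)) ≫
        (Z.map h).toFunctor.map ((Z.map₂ η).toNatTrans.app y) ≫
      eqToHom (congrArg (fun k : Z.obj a ⟶ Z.obj c => k.toFunctor.obj y)
        (Z.map_comp g h).symm) := by
  rw [Z.map₂_whisker_right, Cat.Hom₂.comp_app, Cat.Hom₂.comp_app, mapComp_hom_app,
    mapComp_inv_app, Cat.whiskerRight_app]

/-- Identity law for the objects of the weight. -/
lemma coslice_id_aux (b : B) {x y : Z.obj b} (f : x ⟶ y) :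
    ((Z.mapId b).inv.toNatTrans.app x ≫ (Z.map (𝟙 b)).toFunctor.map f) ≫
      eqToHom (congrArg (fun k : Z.obj b ⟶ Z.obj b => k.toFunctor.obj y) (Z.map_id b)) = f := by
  have h := (Z.mapId b).hom.toNatTrans.naturality f
  have h' := Cat.Hom.inv_hom_id_toNatTrans_app (Z.mapId b) x
  rw [mapId_hom_app Z b y] at h
  rw [Category.assoc, h, reassoc_of% h']
  rfl

/-- Composition law for the objects of the weight. -/
lemma coslice_comp_aux {a b c : B} (f : a ⟶ b) (g : b ⟶ c) {x t : Z.obj a} {y : Z.obj b}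
    {z : Z.obj c} (α : y ⟶ (Z.map f).toFunctor.obj x) (β : z ⟶ (Z.map g).toFunctor.obj y)
    (k : x ⟶ t) :
    ((β ≫ (Z.map g).toFunctor.map α ≫ (Z.mapComp f g).inv.toNatTrans.app x) ≫
      (Z.map (f ≫ g)).toFunctor.map k) ≫
      eqToHom (congrArg (fun k : Z.obj a ⟶ Z.obj c => k.toFunctor.obj t) (Z.map_comp f g)) =
    β ≫ (Z.map g).toFunctor.map (α ≫ (Z.map f).toFunctor.map k) := by
  have h := (Z.mapComp f g).hom.toNatTrans.naturality k
  have h' := Cat.Hom.inv_hom_id_toNatTrans_app (Z.mapComp f g) x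
  rw [mapComp_hom_app Z f g t] at h
  simp only [Category.assoc]
  rw [h, reassoc_of% h']
  simp

end

/-- The weight `(b, x) ↦ x / Z(b)`. -/
def cosliceWeight (Z : StrictPseudofunctor Aᵒᵖ Cat.{u, u}) :
    StrictPseudofunctor (Elements Z)ᵒᵖ Cat.{u, u} :=
  StrictPseudofunctor.mk''
    { obj := fun X => Cat.of (Under X.unop.fiber)
      map := fun p => (cosliceMap p.unop).toCatHom
      map₂ := fun δ => (cosliceMap₂ δ.unop2).toCatHom₂
      map₂_id := fun p => by
        refine Cat.Hom₂.ext (NatTrans.ext (funext fun T => Under.UnderMorphism.ext ?_))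
        change (Z.map₂ (𝟙 p.unop.base.op)).toNatTrans.app (Comma.right T) =
          𝟙 ((Z.map p.unop.base.op).toFunctor.obj (Comma.right T))
        rw [Z.map₂_id]
        simp
      map₂_comp := fun η θ => by
        refine Cat.Hom₂.ext (NatTrans.ext (funext fun T => Under.UnderMorphism.ext ?_))
        change (Z.map₂ (op2 (Elements.Hom₂.cell η.unop2) ≫
          op2 (Elements.Hom₂.cell θ.unop2))).toNatTrans.app (Comma.right T) = _
        rw [Z.map₂_comp]
        rfl
      map_id := fun X => by
        refine Cat.ext (under_functor_ext
          (fun T => congrArg (fun k : Z.obj _ ⟶ Z.obj _ => k.toFunctor.obj (Comma.right T))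
            (Z.map_id (op X.unop.base))) (fun T => ?_) (fun {T T'} t => ?_))
        · exact coslice_id_aux Z (op X.unop.base) (Comma.hom T)
        · have h := (Z.mapId (op X.unop.base)).hom.toNatTrans.naturality (CommaMorphism.right t)
          rw [mapId_hom_app, mapId_hom_app] at h
          exact h
      map_comp := fun {X Y V} f g => by
        refine Cat.ext (under_functor_ext
          (fun T => congrArg (fun k : Z.obj _ ⟶ Z.obj _ => k.toFunctor.obj (Comma.right T))
            (Z.map_comp f.unop.base.op g.unop.base.op)) (fun T => ?_) (fun {T T'} t => ?_))
        · exact coslice_comp_aux Z f.unop.base.op g.unop.base.op f.unop.fiber g.unop.fiber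
            (Comma.hom T)
        · have h := (Z.mapComp f.unop.base.op g.unop.base.op).hom.toNatTrans.naturality
            (CommaMorphism.right t)
          rw [mapComp_hom_app, mapComp_hom_app] at h
          exact h
      map₂_whisker_left := fun f g h η => by
        refine Cat.Hom₂.ext (NatTrans.ext (funext fun T => Under.UnderMorphism.ext ?_))
        erw [conj_app, Under.comp_right, Under.comp_right, under_eqToHom_right,
          under_eqToHom_right]
        exact map₂_whiskerLeft_app Z f.unop.base.op (op2 (Elements.Hom₂.cell η.unop2)) _
      map₂_whisker_right := fun η f => by
        refine Cat.Hom₂.ext (NatTrans.ext (funext fun T => Under.UnderMorphism.ext ?_))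
        erw [conj_app, Under.comp_right, Under.comp_right, under_eqToHom_right,
          under_eqToHom_right]
        exact map₂_whiskerRight_app Z (op2 (Elements.Hom₂.cell η.unop2)) f.unop.base.op _ }

end Weight

end OplaxColim

namespace OplaxColim

/-! ### Heterogeneous equality of `2`-cells -/

section HEq

/-! Both statements are instances of one construction. Take a 2-functor `P : B' → B`, a weight `V`
on `B`, and an oplax transformation `s` from the constant 2-functor at `1` to the restriction of `V`
along `P` (`OplaxSection`). A 2-natural `w : V → C(F(-), U)` can be evaluated at `s`: the legs
`w(s_X)` and the cells `w(s_p)` form an oplax cone on `F ∘ P` (`OplaxSection.cone`), whose cells are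
identities wherever those of `s` are. Evaluation commutes with postcomposition. Hence, once it is
fully faithful and bijective on objects for each `U`, it is an isomorphism of categories 2-natural
in `U` (`OplaxSection.coconesIso`), so the two colimits have the same universal property
(`CoconesIso.nonempty_colimitData_iff`). The usual Yoneda argument then makes two such colimits
isomorphic (`ColimitData.nonempty_iso`).

For the first statement, `P` is the projection of `∫W`, and `s` picks `x` at `(a, x)`. Each morphism
`(f, α)` is the vertical `(1, α)` followed by the cartesian `(f, 1)` (`vert_fiber_comp_cart`), and a
marked cone is trivial on the latter. The cone is therefore given by its legs and its vertical
cells, that is, by functors `W(a) ⥤ C(F a, U)`. Triviality on cartesian morphisms is naturality in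
`f`, and compatibility of the cone with 2-cells is compatibility of these functors with 2-cells of
`A` (`weightedCocone`).

For the second statement, `P` is the identity of `∫Z`, `V` is the coslice weight, and `s` picks the
identity of `x` at `(b, x)`. As in the Yoneda lemma, an object `γ : x ⟶ t` of the coslice is the
image of the identity of `t` under the action of `(1, γ)` (`cosliceMap_underVert_obj`), so `w(γ)`
has to be `F(1, γ)` followed by the leg at `t`. This formula is 2-natural because `(f, α)` followed
by a vertical morphism is again a vertical morphism followed by `(f, 1)` (`vert_comp_cart`); see
`cosliceCocone`.

All 2-categories are strict, so many 2-cells to be compared have ends that are equal only by a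
proof. They are compared by `HEq`, under which identity cells and associators disappear from
composites. -/

lemma comp_heq {X : Type u₁} [Category.{v₁} X] {x y z x' y' z' : X} {f : x ⟶ y} {g : y ⟶ z}
    {f' : x' ⟶ y'} {g' : y' ⟶ z'} (hx : x = x') (hy : y = y') (hz : z = z')
    (hf : f ≍ f') (hg : g ≍ g') : f ≫ g ≍ f' ≫ g' := by
  subst hx hy hz; cases hf; cases hg; rfl

lemma functor_map_heq {X : Type u₁} [Category.{v₁} X] {Y : Type u₂} [Category.{v₂} Y]
    {G G' : X ⥤ Y} (hG : G = G') {x y x' y' : X} {f : x ⟶ y} {f' : x' ⟶ y'}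
    (hx : x = x') (hy : y = y') (hf : f ≍ f') : G.map f ≍ G'.map f' := by
  subst hG hx hy; cases hf; rfl

variable {D : Type u₂} [Bicategory.{w₂, v₂} D]

lemma IsIdCell.heq {a b : D} {f g f' g' : a ⟶ b} {η : f ⟶ g} {θ : f' ⟶ g'} (hη : IsIdCell η)
    (hθ : IsIdCell θ) (h : f = f') : η ≍ θ := by
  obtain ⟨rfl, rfl⟩ := hη
  obtain ⟨rfl, rfl⟩ := hθ
  subst h; rfl

lemma IsIdCell.of_heq {a b : D} {f g f' g' : a ⟶ b} {η : f ⟶ g} {θ : f' ⟶ g'} (hη : IsIdCell η)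
    (h : f = f') (h' : g = g') (e : η ≍ θ) : IsIdCell θ := by
  subst h h'; cases e; exact hη

lemma IsIdCell.id {a b : D} (f : a ⟶ b) : IsIdCell (𝟙 f) := ⟨rfl, rfl⟩

lemma IsIdCell.eqToHom {a b : D} {f g : a ⟶ b} (h : f = g) : IsIdCell (eqToHom h) := ⟨h, rfl⟩

/-- With the next lemma, this is how marked cells, whose ends are equal but not definitionally so,
are dropped from composites. -/
lemma IsIdCell.comp_heq {a b : D} {f g h : a ⟶ b} {η : f ⟶ g} (θ : g ⟶ h) (hη : IsIdCell η) :
    η ≫ θ ≍ θ := by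
  obtain ⟨rfl, rfl⟩ := hη
  simp

lemma IsIdCell.heq_comp {a b : D} {f g h : a ⟶ b} (η : f ⟶ g) {θ : g ⟶ h} (hθ : IsIdCell θ) :
    η ≫ θ ≍ η := by
  obtain ⟨rfl, rfl⟩ := hθ
  simp

lemma whiskerLeft_heq {a b c : D} {k l : a ⟶ b} {f g f' g' : b ⟶ c} {η : f ⟶ g} {η' : f' ⟶ g'}
    (h : k = l) (hf : f = f') (hg : g = g') (e : η ≍ η') : k ◁ η ≍ l ◁ η' := by
  subst h hf hg; cases e; rfl

lemma whiskerRight_heq {a b c : D} {k l : b ⟶ c} {f g f' g' : a ⟶ b} {η : f ⟶ g} {η' : f' ⟶ g'}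
    (h : k = l) (hf : f = f') (hg : g = g') (e : η ≍ η') : η ▷ k ≍ η' ▷ l := by
  subst h hf hg; cases e; rfl

variable [Bicategory.Strict D]

/-- Associators and unitors of a strict 2-category are `eqToHom`s, so the bicategorical whiskering
laws lose them when read as heterogeneous equalities. The same holds for the next four lemmas. -/
lemma whiskerLeft_whiskerLeft_heq {a b c d : D} (k : a ⟶ b) (l : b ⟶ c) {f g : c ⟶ d} (η : f ⟶ g) :
    k ◁ l ◁ η ≍ (k ≫ l) ◁ η := by
  simp [Bicategory.Strict.associator_eqToIso]

lemma whiskerRight_whiskerRight_heq {a b c d : D} {f g : a ⟶ b} (η : f ⟶ g) (k : b ⟶ c)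
    (l : c ⟶ d) : (η ▷ k) ▷ l ≍ η ▷ (k ≫ l) := by
  simp [Bicategory.Strict.associator_eqToIso]

lemma whiskerRight_whiskerLeft_heq {a b c d : D} (k : a ⟶ b) {f g : b ⟶ c} (η : f ⟶ g)
    (l : c ⟶ d) : (k ◁ η) ▷ l ≍ k ◁ (η ▷ l) := by
  simp [Bicategory.Strict.associator_eqToIso]

lemma id_whiskerLeft_heq {a b : D} {f g : a ⟶ b} (η : f ⟶ g) : 𝟙 a ◁ η ≍ η := by
  simp [Bicategory.Strict.leftUnitor_eqToIso]

lemma whiskerRight_id_heq {a b : D} {f g : a ⟶ b} (η : f ⟶ g) : η ▷ 𝟙 b ≍ η := by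
  simp [Bicategory.Strict.rightUnitor_eqToIso]

end HEq

/-! ### Isomorphisms of categories -/

section Iso

variable {X Y : Type u} [Category.{v} X] [Category.{v} Y]

/-- The strict inverse of a fully faithful functor that is bijective on objects. -/
noncomputable def strictInverse (G : X ⥤ Y) (hG : G.FullyFaithful)
    (hs : Function.Surjective G.obj) : Y ⥤ X where
  obj y := Function.surjInv hs y
  map {y y'} f := hG.preimage (eqToHom (Function.surjInv_eq hs y) ≫ f ≫
    eqToHom (Function.surjInv_eq hs y').symm)
  map_id _ := hG.map_injective (by simp)
  map_comp _ _ := hG.map_injective (by simp)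

/-- Injectivity on objects is needed here only: it forces the chosen preimage of `G.obj x` to be `x`
itself, not merely an object isomorphic to it. -/
lemma comp_strictInverse (G : X ⥤ Y) (hG : G.FullyFaithful) (hi : Function.Injective G.obj)
    (hs : Function.Surjective G.obj) : G ⋙ strictInverse G hG hs = 𝟭 X := by
  have h : ∀ x, Function.surjInv hs (G.obj x) = x := fun x => hi (Function.surjInv_eq hs (G.obj x))
  exact CategoryTheory.Functor.ext h
    fun x y f => hG.map_injective (by
      simp only [Functor.comp_map, strictInverse, Functor.FullyFaithful.map_preimage,
        Functor.id_map, Functor.map_comp, eqToHom_map]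
      exact congrArg (_ ≫ G.map f ≫ ·) (eqToHom_map G (h y).symm).symm)

lemma strictInverse_comp (G : X ⥤ Y) (hG : G.FullyFaithful) (hs : Function.Surjective G.obj) :
    strictInverse G hG hs ⋙ G = 𝟭 Y :=
  CategoryTheory.Functor.ext (fun y => Function.surjInv_eq hs y)
    fun x y f => by simp [strictInverse]

/-- A fully faithful functor that is bijective on objects is an isomorphism of categories. -/
noncomputable def catIsoOfBijective (G : X ⥤ Y) (hG : G.FullyFaithful)
    (hi : Function.Injective G.obj) (hs : Function.Surjective G.obj) : Cat.of X ≅ Cat.of Y where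
  hom := G.toCatHom
  inv := (strictInverse G hG hs).toCatHom
  hom_inv_id := Cat.ext (comp_strictInverse G hG hi hs)
  inv_hom_id := Cat.ext (strictInverse_comp G hG hs)

end Iso

/-! ### Transporting colimits along isomorphisms of categories of cocones -/

section Transport

/-- Isomorphisms between two categories of cocones, `2`-natural in the vertex. -/
structure CoconesIso {B : Type u} [Bicategory.{u, u} B] [Bicategory.Strict B]
    {B' : Type u} [Bicategory.{u, u} B'] [Bicategory.Strict B']
    {C : Type u₁} [Bicategory.{u, u} C] [Bicategory.Strict C]
    (S : MorphismProperty Bᵒᵖ) (W : StrictPseudofunctor Bᵒᵖ Cat.{u, u})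
    (F : StrictPseudofunctor B C)
    (S' : MorphismProperty B'ᵒᵖ) (W' : StrictPseudofunctor B'ᵒᵖ Cat.{u, u})
    (F' : StrictPseudofunctor B' C) where
  iso (U : C) : Cat.of (Cocones S W F U) ≅ Cat.of (Cocones S' W' F' U)
  naturality {U V : C} (k : U ⟶ V) :
    (coconesMap S W F k).toCatHom ≫ (iso V).hom = (iso U).hom ≫ (coconesMap S' W' F' k).toCatHom
  naturality₂ {U V : C} {k l : U ⟶ V} (κ : k ⟶ l) :
    (coconesMap₂ S W F κ).toCatHom₂ ▷ (iso V).hom ≍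
      (iso U).hom ◁ (coconesMap₂ S' W' F' κ).toCatHom₂

variable {B : Type u} [Bicategory.{u, u} B] [Bicategory.Strict B]
  {B' : Type u} [Bicategory.{u, u} B'] [Bicategory.Strict B']
  {C : Type u₁} [Bicategory.{u, u} C] [Bicategory.Strict C]
  {S : MorphismProperty Bᵒᵖ} {W : StrictPseudofunctor Bᵒᵖ Cat.{u, u}}
  {F : StrictPseudofunctor B C}
  {S' : MorphismProperty B'ᵒᵖ} {W' : StrictPseudofunctor B'ᵒᵖ Cat.{u, u}}
  {F' : StrictPseudofunctor B' C}

lemma iso_square_inv {D : Type u₂} [Bicategory.{w₂, v₂} D] [Bicategory.Strict D] {a b a' b' : D}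
    {i : a ≅ a'} {j : b ≅ b'} {k : a ⟶ b} {k' : a' ⟶ b'}
    (h : k ≫ j.hom = i.hom ≫ k') : k' ≫ j.inv = i.inv ≫ k := by
  have h₁ : i.hom ≫ k' ≫ j.inv = k := by
    rw [← Bicategory.Strict.assoc, ← h, Bicategory.Strict.assoc, j.hom_inv_id,
      Bicategory.Strict.comp_id]
  rw [← h₁, ← Bicategory.Strict.assoc, i.inv_hom_id, Bicategory.Strict.id_comp]

/-- By `h`, whiskering `κ'` with `i.hom` and `j.inv` amounts to whiskering `κ` with `j.hom ≫ j.inv`,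
which gives `κ` back. A further whiskering with `i.inv` cancels `i.hom`. -/
lemma iso_square_inv₂ {D : Type u₂} [Bicategory.{w₂, v₂} D] [Bicategory.Strict D] {a b a' b' : D}
    {i : a ≅ a'} {j : b ≅ b'} {k l : a ⟶ b} {k' l' : a' ⟶ b'} {κ : k ⟶ l} {κ' : k' ⟶ l'}
    (hk : k ≫ j.hom = i.hom ≫ k') (hl : l ≫ j.hom = i.hom ≫ l')
    (h : κ ▷ j.hom ≍ i.hom ◁ κ') : κ' ▷ j.inv ≍ i.inv ◁ κ := by
  have e : ∀ {m : a ⟶ b} {m' : a' ⟶ b'}, m ≫ j.hom = i.hom ≫ m' → i.hom ≫ m' ≫ j.inv = m :=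
    fun h => by
      rw [← Bicategory.Strict.assoc, ← h, Bicategory.Strict.assoc, j.hom_inv_id,
        Bicategory.Strict.comp_id]
  have h₁ : i.hom ◁ (κ' ▷ j.inv) ≍ κ :=
    (whiskerRight_whiskerLeft_heq _ _ _).symm.trans
      ((whiskerRight_heq rfl hk.symm hl.symm h.symm).trans
        ((whiskerRight_whiskerRight_heq _ _ _).trans
          ((whiskerRight_heq j.hom_inv_id rfl rfl HEq.rfl).trans (whiskerRight_id_heq _))))
  exact (id_whiskerLeft_heq _).symm.trans
    ((whiskerLeft_heq i.inv_hom_id.symm rfl rfl HEq.rfl).trans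
      ((whiskerLeft_whiskerLeft_heq _ _ _).symm.trans
        (whiskerLeft_heq rfl (e hk) (e hl) h₁)))

/-- The inverse isomorphisms of categories of cocones. -/
def CoconesIso.symm (Θ : CoconesIso S W F S' W' F') : CoconesIso S' W' F' S W F where
  iso U := (Θ.iso U).symm
  naturality k := iso_square_inv (Θ.naturality k)
  naturality₂ {_ _ k l} κ := iso_square_inv₂ (Θ.naturality k) (Θ.naturality l) (Θ.naturality₂ κ)

lemma ColimitData.naturality₂_heq {L : C} (D : ColimitData S W F L) {U V : C} {k l : U ⟶ V}
    (κ : k ⟶ l) : (postcomposingCat L U V).map κ ▷ (D.iso V).hom ≍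
      (D.iso U).hom ◁ (coconesMap₂ S W F κ).toCatHom₂ := by
  rw [D.naturality₂ κ]
  simp

/-- Colimits are transported along `2`-natural isomorphisms of categories of cocones. -/
def ColimitData.transport {L : C} (D : ColimitData S W F L) (Θ : CoconesIso S W F S' W' F') :
    ColimitData S' W' F' L :=
  have nat : ∀ {U V : C} (k : U ⟶ V), (postcomposingCat L U V).obj k ≫
      (D.iso V ≪≫ Θ.iso V).hom = (D.iso U ≪≫ Θ.iso U).hom ≫
        (coconesMap S' W' F' k).toCatHom := fun {U V} k => by
    change (postcomposingCat L U V).obj k ≫ (D.iso V).hom ≫ (Θ.iso V).hom = _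
    rw [← Bicategory.Strict.assoc, D.naturality, Bicategory.Strict.assoc, Θ.naturality,
      ← Bicategory.Strict.assoc]
    rfl
  { iso := fun U => D.iso U ≪≫ Θ.iso U
    naturality := nat
    naturality₂ := fun {U V k l} κ => by
      apply eq_of_heq
      -- Without the conjugating `eqToHom`s, the claim is the pasting of the square of `D` with the
      -- square of `Θ`.
      rw [heq_eqToHom_comp_iff, heq_comp_eqToHom_iff]
      exact (whiskerRight_whiskerRight_heq _ _ _).symm.trans
        ((whiskerRight_heq rfl (D.naturality k) (D.naturality l) (D.naturality₂_heq κ)).trans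
          ((whiskerRight_whiskerLeft_heq _ _ _).trans
            ((whiskerLeft_heq rfl (Θ.naturality k) (Θ.naturality l) (Θ.naturality₂ κ)).trans
              (whiskerLeft_whiskerLeft_heq _ _ _)))) }

lemma CoconesIso.nonempty_colimitData_iff (Θ : CoconesIso S W F S' W' F') (L : C) :
    Nonempty (ColimitData S W F L) ↔ Nonempty (ColimitData S' W' F' L) :=
  ⟨fun ⟨D⟩ => ⟨D.transport Θ⟩, fun ⟨D⟩ => ⟨D.transport Θ.symm⟩⟩

/-- The cocone corresponding to a `1`-cell out of a colimit. -/
def ColimitData.cocone {L : C} (D : ColimitData S W F L) {U : C} (x : L ⟶ U) : Cocones S W F U :=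
  (D.iso U).hom.toFunctor.obj x

/-- The `1`-cell out of a colimit corresponding to a cocone. -/
def ColimitData.desc {L : C} (D : ColimitData S W F L) {U : C} (y : Cocones S W F U) : L ⟶ U :=
  (D.iso U).inv.toFunctor.obj y

lemma ColimitData.cocone_desc {L : C} (D : ColimitData S W F L) {U : C} (y : Cocones S W F U) :
    D.cocone (D.desc y) = y :=
  congrArg (fun G : Cat.of (Cocones S W F U) ⟶ Cat.of (Cocones S W F U) => G.toFunctor.obj y)
    (D.iso U).inv_hom_id

lemma ColimitData.desc_cocone {L : C} (D : ColimitData S W F L) {U : C} (x : L ⟶ U) :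
    D.desc (D.cocone x) = x :=
  congrArg (fun G : Cat.of (L ⟶ U) ⟶ Cat.of (L ⟶ U) => G.toFunctor.obj x) (D.iso U).hom_inv_id

lemma ColimitData.cocone_comp {L : C} (D : ColimitData S W F L) {U V : C} (x : L ⟶ U)
    (k : U ⟶ V) : D.cocone (x ≫ k) = (coconesMap S W F k).obj (D.cocone x) :=
  congrArg (fun G : Cat.of (L ⟶ U) ⟶ Cat.of (Cocones S W F V) => G.toFunctor.obj x)
    (D.naturality k)

/-- Yoneda: by naturality in the vertex, both sides correspond under `D'` to the cocone `D.cocone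
x`. Applied in both directions, this shows that the comparison 1-cells between two colimits are
mutually inverse. -/
lemma ColimitData.desc_cocone_id_comp {L L' : C} (D : ColimitData S W F L)
    (D' : ColimitData S W F L') {U : C} (x : L ⟶ U) :
    D'.desc (D.cocone (𝟙 L)) ≫ x = D'.desc (D.cocone x) := by
  have h := D'.cocone_comp (D'.desc (D.cocone (𝟙 L))) x
  rw [D'.cocone_desc, ← D.cocone_comp, Bicategory.Strict.id_comp] at h
  rw [← h, D'.desc_cocone]

/-- Two `2`-colimits of the same diagram are isomorphic. -/
lemma ColimitData.nonempty_iso {L L' : C} (D : ColimitData S W F L) (D' : ColimitData S W F L') :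
    Nonempty (L ≅ L') :=
  ⟨{  hom := D.desc (D'.cocone (𝟙 L'))
      inv := D'.desc (D.cocone (𝟙 L))
      hom_inv_id := by
        rw [D'.desc_cocone_id_comp D, D'.cocone_desc, D.desc_cocone]
      inv_hom_id := by
        rw [D.desc_cocone_id_comp D', D.cocone_desc, D'.desc_cocone] }⟩

end Transport

/-! ### Extensionality for oplax transformations and for 2-cells of `Cat` -/

section

variable {B : Type u₁} [Bicategory.{w₁, v₁} B] {D : Type u₂} [Bicategory.{w₂, v₂} D]

lemma oplaxTrans_ext {M N : B ⥤ᵒᵖᴸ D} {σ τ : Oplax.OplaxTrans M N}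
    (h : ∀ b, σ.app b = τ.app b)
    (h' : ∀ {a b : B} (f : a ⟶ b), σ.naturality f ≍ τ.naturality f) : σ = τ := by
  cases σ; cases τ
  obtain rfl := funext h
  congr
  funext a b f
  exact eq_of_heq (h' f)

lemma IsIdCell.of_comp {a b : D} {f g h : a ⟶ b} {η : f ⟶ g} {θ : g ⟶ h}
    (h₁ : IsIdCell (η ≫ θ)) (hθ : IsIdCell θ) : IsIdCell η := by
  obtain ⟨rfl, rfl⟩ := hθ
  rwa [eqToHom_refl, Category.comp_id] at h₁

lemma functor_discrete_ext {X : Type u} [Category.{v} X] {G H : Discrete PUnit.{w + 1} ⥤ X}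
    (h : G.obj ⟨⟨⟩⟩ = H.obj ⟨⟨⟩⟩) : G = H :=
  CategoryTheory.Functor.ext (fun _ => h) <| by
    rintro ⟨⟨⟩⟩ ⟨⟨⟩⟩ f
    obtain rfl : f = 𝟙 _ := Subsingleton.elim _ _
    rw [CategoryTheory.Functor.map_id, CategoryTheory.Functor.map_id, Category.id_comp,
      eqToHom_trans]
    rfl

lemma functor_map_id_comp {X : Type u} [Category.{v} X] {Y : Type u₁} [Category.{v₁} Y]
    (G : X ⥤ Y) (x : X) {y : Y} (f : G.obj x ⟶ y) : G.map (𝟙 x) ≫ f = f := by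
  simp

lemma cat_heq_of_app {P Q : Cat.{v, u}} {G G' H H' : P ⟶ Q} {η : G ⟶ G'} {θ : H ⟶ H'}
    (h : G = H) (h' : G' = H') (e : ∀ x, η.toNatTrans.app x ≍ θ.toNatTrans.app x) : η ≍ θ := by
  subst h h'
  exact heq_of_eq (Cat.Hom₂.ext (NatTrans.ext (funext fun x => eq_of_heq (e x))))

lemma cat_app_heq {P Q : Cat.{v, u}} {G G' H H' : P ⟶ Q} {η : G ⟶ G'} {θ : H ⟶ H'}
    (h : G = H) (h' : G' = H') (e : η ≍ θ) (x : P) : η.toNatTrans.app x ≍ θ.toNatTrans.app x := by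
  subst h h'
  cases e; rfl

lemma IsIdCell.app {P Q : Cat.{v, u}} {G H : P ⟶ Q} {η : G ⟶ H} (h : IsIdCell η) (x : P) :
    ∃ e : G.toFunctor.obj x = H.toFunctor.obj x, η.toNatTrans.app x = CategoryTheory.eqToHom e := by
  obtain ⟨rfl, rfl⟩ := h
  exact ⟨rfl, rfl⟩

end

/-! ### Unit and composition laws of `Cat`-valued oplax transformations -/

section

variable {B : Type u} [Bicategory.{u, u} B] (M N : StrictPseudofunctor B Cat.{u, u})

/-- The composition law of an oplax transformation with values in `Cat`, on components. -/
lemma oplax_comp_iff {a b c : B} (f : a ⟶ b) (g : b ⟶ c) (sa : M.obj a ⟶ N.obj a)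
    (sb : M.obj b ⟶ N.obj b) (sc : M.obj c ⟶ N.obj c) (nf : M.map f ≫ sb ⟶ sa ≫ N.map f)
    (ng : M.map g ≫ sc ⟶ sb ≫ N.map g) (n : M.map (f ≫ g) ≫ sc ⟶ sa ≫ N.map (f ≫ g)) :
    n ≫ sa ◁ (oplax N).mapComp f g = (oplax M).mapComp f g ▷ sc ≫ (α_ _ _ _).hom ≫
      M.map f ◁ ng ≫ (α_ _ _ _).inv ≫ nf ▷ N.map g ≫ (α_ _ _ _).hom ↔
    ∀ x : M.obj a, n.toNatTrans.app x ≍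
      ng.toNatTrans.app ((M.map f).toFunctor.obj x) ≫
        (N.map g).toFunctor.map (nf.toNatTrans.app x) := by
  have key : ∀ x : M.obj a, (n ≫ sa ◁ (oplax N).mapComp f g).toNatTrans.app x =
      ((oplax M).mapComp f g ▷ sc ≫ (α_ _ _ _).hom ≫
      M.map f ◁ ng ≫ (α_ _ _ _).inv ≫ nf ▷ N.map g ≫ (α_ _ _ _).hom).toNatTrans.app x ↔
      n.toNatTrans.app x ≍
      ng.toNatTrans.app ((M.map f).toFunctor.obj x) ≫
        (N.map g).toFunctor.map (nf.toNatTrans.app x) := by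
    intro x
    -- The components of `mapComp` are `eqToHom`s and those of the associators of `Cat` are
    -- identities, so only `n`, `ng` and `nf` survive on the two sides.
    have h₁ : (n ≫ sa ◁ (oplax N).mapComp f g).toNatTrans.app x ≍ n.toNatTrans.app x := by
      change n.toNatTrans.app x ≫ (N.mapComp f g).hom.toNatTrans.app (sa.toFunctor.obj x) ≍ _
      rw [mapComp_hom_app]
      exact comp_eqToHom_heq _ _
    have h₂ : ((oplax M).mapComp f g ▷ sc ≫ (α_ _ _ _).hom ≫
      M.map f ◁ ng ≫ (α_ _ _ _).inv ≫ nf ▷ N.map g ≫ (α_ _ _ _).hom).toNatTrans.app x ≍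
        ng.toNatTrans.app ((M.map f).toFunctor.obj x) ≫
        (N.map g).toFunctor.map (nf.toNatTrans.app x) := by
      change sc.toFunctor.map ((M.mapComp f g).hom.toNatTrans.app x) ≫ 𝟙 _ ≫
        ng.toNatTrans.app ((M.map f).toFunctor.obj x) ≫ 𝟙 _ ≫
          (N.map g).toFunctor.map (nf.toNatTrans.app x) ≫ 𝟙 _ ≍ _
      rw [mapComp_hom_app, eqToHom_map, Category.id_comp, Category.id_comp, Category.comp_id]
      exact eqToHom_comp_heq _ _
    exact ⟨fun h => h₁.symm.trans ((heq_of_eq h).trans h₂),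
      fun h => eq_of_heq (h₁.trans (h.trans h₂.symm))⟩
  exact ⟨fun h x => (key x).1 (by rw [h]),
    fun h => Cat.Hom₂.ext (NatTrans.ext (funext fun x => (key x).2 (h x)))⟩

/-- Every cell of the unit law other than `n` is an identity cell, and parallel identity cells
coincide. The next lemma is the converse, so the unit law says exactly that `n` is an identity cell.
-/
lemma oplax_id_of_isIdCell {a : B} (sa : M.obj a ⟶ N.obj a)
    {n : M.map (𝟙 a) ≫ sa ⟶ sa ≫ N.map (𝟙 a)} (hn : IsIdCell n) :
    n ≫ sa ◁ (oplax N).mapId a = (oplax M).mapId a ▷ sa ≫ (λ_ sa).hom ≫ (ρ_ sa).inv :=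
  IsIdCell.unique (.comp hn (.whiskerLeft _ (.of_eq (N.mapId_eq_eqToIso a))))
    (.comp (.whiskerRight (.of_eq (M.mapId_eq_eqToIso a)) _)
      (.comp (.leftUnitor _) (.rightUnitor_inv _)))

lemma isIdCell_of_oplax_id {a : B} (sa : M.obj a ⟶ N.obj a)
    {n : M.map (𝟙 a) ≫ sa ⟶ sa ≫ N.map (𝟙 a)}
    (h : n ≫ sa ◁ (oplax N).mapId a = (oplax M).mapId a ▷ sa ≫ (λ_ sa).hom ≫ (ρ_ sa).inv) :
    IsIdCell n := by
  have h₁ : IsIdCell ((oplax M).mapId a ▷ sa ≫ (λ_ sa).hom ≫ (ρ_ sa).inv) :=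
    (.comp (.whiskerRight (.of_eq (M.mapId_eq_eqToIso a)) _)
      (.comp (.leftUnitor _) (.rightUnitor_inv _)))
  have h₂ : IsIdCell (sa ◁ (oplax N).mapId a) := .whiskerLeft _ (.of_eq (N.mapId_eq_eqToIso a))
  rw [← h] at h₁
  exact h₁.of_comp h₂

end

/-! ### Whiskering with the images of identities and composites -/

section

variable {B : Type u} [Bicategory.{u, u} B]
  {C : Type u₁} [Bicategory.{u, u} C] [Bicategory.Strict C]

lemma id_map_heq (F : StrictPseudofunctor B C) {a : B} {U : C}
    {x y : F.obj a ⟶ U} (η : x ⟶ y) : F.map (𝟙 a) ◁ η ≍ η :=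
  (whiskerLeft_heq (F.map_id a) rfl rfl HEq.rfl).trans (id_whiskerLeft_heq _)

lemma id_map_obj (F : StrictPseudofunctor B C) {a : B} {U : C}
    (x : F.obj a ⟶ U) : F.map (𝟙 a) ≫ x = x := by
  rw [F.map_id, Bicategory.Strict.id_comp]

end

section

variable {B : Type u} [Bicategory.{u, u} B] [Bicategory.Strict B]
  {C : Type u₁} [Bicategory.{u, u} C] [Bicategory.Strict C]

lemma comp_map_heq (F : StrictPseudofunctor B C) {a b c : B} (f : a ⟶ b) (g : b ⟶ c) {U : C}
    {x y : F.obj c ⟶ U} (η : x ⟶ y) : F.map f ◁ F.map g ◁ η ≍ F.map (f ≫ g) ◁ η :=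
  (whiskerLeft_whiskerLeft_heq _ _ _).trans (whiskerLeft_heq (F.map_comp f g).symm rfl rfl HEq.rfl)

lemma comp_map_obj (F : StrictPseudofunctor B C) {a b c : B} (f : a ⟶ b) (g : b ⟶ c) {U : C}
    (x : F.obj c ⟶ U) : F.map f ≫ F.map g ≫ x = F.map (f ≫ g) ≫ x := by
  rw [F.map_comp, Bicategory.Strict.assoc]

/-! ### Oplax cones in elementary terms -/

/-- An oplax natural transformation `Δ1 ⟶ C(F(-), U)` in elementary terms. -/
structure OplaxCone (F : StrictPseudofunctor B C) (U : C) where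
  leg (X : B) : F.obj X ⟶ U
  cell {X Y : B} (p : X ⟶ Y) : leg X ⟶ F.map p ≫ leg Y
  cell_map₂ {X Y : B} {p q : X ⟶ Y} (δ : p ⟶ q) : cell p ≫ F.map₂ δ ▷ leg Y = cell q
  cell_id (X : B) : IsIdCell (cell (𝟙 X))
  cell_comp {X Y Z : B} (p : X ⟶ Y) (q : Y ⟶ Z) : cell (p ≫ q) ≍ cell p ≫ F.map p ◁ cell q

namespace OplaxCone

variable {F : StrictPseudofunctor B C} {U : C}

/-- The transformation described by an `OplaxCone`. -/
def toTrans (c : OplaxCone F U) : oplax (constOne Bᵒᵖ) ⟶ oplax (homInto F U) :=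
  Oplax.OplaxTrans.mk (fun X => ((Functor.const _).obj (c.leg X.unop)).toCatHom)
    (fun p => Cat.Hom₂.ofNatTrans (Discrete.natTrans fun _ => c.cell p.unop))
    (fun {X Y p q} η => by
      refine Cat.Hom₂.ext (NatTrans.ext (funext fun _ => ?_))
      change 𝟙 _ ≫ c.cell q.unop = c.cell p.unop ≫ F.map₂ η.unop2 ▷ c.leg X.unop
      rw [c.cell_map₂, Category.id_comp])
    (fun X => oplax_id_of_isIdCell _ _ _ (.of_app _ fun _ => c.cell_id X.unop))
    (fun {X Y Z} p q => (oplax_comp_iff (constOne Bᵒᵖ) (homInto F U) p q _ _ _ _ _ _).2 fun _ =>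
      c.cell_comp q.unop p.unop)

/-- The elementary data of an oplax natural transformation `Δ1 ⟶ C(F(-), U)`. -/
def ofTrans (σ : oplax (constOne Bᵒᵖ) ⟶ oplax (homInto F U)) : OplaxCone F U where
  leg X := (σ.app (op X)).toFunctor.obj ⟨⟨⟩⟩
  cell p := (σ.naturality p.op).toNatTrans.app ⟨⟨⟩⟩
  cell_map₂ {X Y p q} δ := by
    have h := congrArg (fun η => η.toNatTrans.app ⟨⟨⟩⟩) (σ.naturality_naturality (op2 δ))
    exact h.symm.trans (functor_map_id_comp (σ.app (op X)).toFunctor _ _)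
  cell_id X := (isIdCell_of_oplax_id (constOne Bᵒᵖ) (homInto F U) _ (σ.naturality_id (op X))).app _
  cell_comp p q := (oplax_comp_iff (constOne Bᵒᵖ) (homInto F U) q.op p.op _ _ _ _ _ _).1
    (σ.naturality_comp q.op p.op) ⟨⟨⟩⟩

/-- A functor out of the terminal category is an object, and a transformation between two such
functors is a morphism; so legs and cells contain all the data. -/
lemma trans_ext {σ τ : oplax (constOne Bᵒᵖ) ⟶ oplax (homInto F U)}
    (h : ∀ X, (ofTrans σ).leg X = (ofTrans τ).leg X)
    (h' : ∀ {X Y : B} (p : X ⟶ Y), (ofTrans σ).cell p ≍ (ofTrans τ).cell p) : σ = τ := by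
  have e : ∀ X, σ.app X = τ.app X := fun X => Cat.ext (functor_discrete_ext (h X.unop))
  exact oplaxTrans_ext e fun p => cat_heq_of_app (by rw [e]) (by rw [e]) fun ⟨⟨⟩⟩ => h' p.unop

/-- A morphism of oplax cones, as a modification. -/
def homMk {σ τ : oplax (constOne Bᵒᵖ) ⟶ oplax (homInto F U)}
    (m : ∀ X, (ofTrans σ).leg X ⟶ (ofTrans τ).leg X)
    (hm : ∀ {X Y : B} (p : X ⟶ Y), m X ≫ (ofTrans τ).cell p = (ofTrans σ).cell p ≫ F.map p ◁ m Y) :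
    σ ⟶ τ :=
  ⟨⟨fun X => Cat.Hom₂.ofNatTrans (Discrete.natTrans fun _ => m X.unop), fun p => by
    refine Cat.Hom₂.ext (NatTrans.ext (funext fun ⟨⟨⟩⟩ => ?_))
    exact hm p.unop⟩⟩

/-- The components of a modification. -/
def homApp {σ τ : oplax (constOne Bᵒᵖ) ⟶ oplax (homInto F U)} (Γ : σ ⟶ τ) (X : B) :
    (ofTrans σ).leg X ⟶ (ofTrans τ).leg X :=
  (Γ.as.app (op X)).toNatTrans.app ⟨⟨⟩⟩

lemma homApp_naturality {σ τ : oplax (constOne Bᵒᵖ) ⟶ oplax (homInto F U)} (Γ : σ ⟶ τ) {X Y : B}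
    (p : X ⟶ Y) :
    homApp Γ X ≫ (ofTrans τ).cell p = (ofTrans σ).cell p ≫ F.map p ◁ homApp Γ Y :=
  congrArg (fun η => η.toNatTrans.app ⟨⟨⟩⟩) (Γ.as.naturality p.op)

lemma hom_ext {σ τ : oplax (constOne Bᵒᵖ) ⟶ oplax (homInto F U)} {Γ Θ : σ ⟶ τ}
    (h : ∀ X, homApp Γ X = homApp Θ X) : Γ = Θ :=
  Oplax.OplaxTrans.homCategory.ext fun X =>
    Cat.Hom₂.ext (NatTrans.ext (funext fun ⟨⟨⟩⟩ => h X.unop))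

end OplaxCone

/-! ### Weighted cocones in elementary terms -/

/-- A `2`-natural transformation `V ⟶ C(F(-), U)` in elementary terms. -/
structure WeightedCocone (V : StrictPseudofunctor Bᵒᵖ Cat.{u, u}) (F : StrictPseudofunctor B C)
    (U : C) where
  fn (b : B) : V.obj (op b) ⥤ (F.obj b ⟶ U)
  fn_obj {a b : B} (f : a ⟶ b) (x : V.obj (op b)) :
    (fn a).obj ((V.map f.op).toFunctor.obj x) = F.map f ≫ (fn b).obj x
  fn_map {a b : B} (f : a ⟶ b) {x y : V.obj (op b)} (t : x ⟶ y) :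
    (fn a).map ((V.map f.op).toFunctor.map t) ≍ F.map f ◁ (fn b).map t
  fn_map₂ {a b : B} {f g : a ⟶ b} (δ : f ⟶ g) (x : V.obj (op b)) :
    (fn a).map ((V.map₂ (op2 δ)).toNatTrans.app x) ≍ F.map₂ δ ▷ (fn b).obj x

namespace WeightedCocone

variable {V : StrictPseudofunctor Bᵒᵖ Cat.{u, u}} {F : StrictPseudofunctor B C} {U : C}

/-- Collects the object and morphism conditions into one equality of functors; its `eqToHom` serves
as structure cell of the transformation. -/
lemma fn_square (c : WeightedCocone V F U) {a b : B} (f : a ⟶ b) :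
    V.map f.op ≫ (c.fn a).toCatHom = (c.fn b).toCatHom ≫ (homInto F U).map f.op :=
  Cat.ext (CategoryTheory.Functor.hext (c.fn_obj f) fun _ _ t => c.fn_map f t)

/-- The transformation described by a `WeightedCocone`. -/
def toTrans (c : WeightedCocone V F U) : oplax V ⟶ oplax (homInto F U) :=
  Oplax.OplaxTrans.mk (fun X => (c.fn X.unop).toCatHom)
    (fun p => eqToHom (c.fn_square p.unop))
    (fun {X Y p q} η => by
      apply eq_of_heq
      refine (comp_eqToHom_heq _ _).trans (HEq.trans ?_ (eqToHom_comp_heq _ _).symm)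
      exact cat_heq_of_app (c.fn_square p.unop) (c.fn_square q.unop) fun x =>
        c.fn_map₂ η.unop2 x)
    (fun X => oplax_id_of_isIdCell _ _ _ (.eqToHom _))
    -- All structure cells are `eqToHom`s, so both sides of the composition law are composites of
    -- identity cells.
    (fun p q => IsIdCell.unique
      (.comp (.eqToHom _) (.whiskerLeft _ (.of_eq ((homInto F U).mapComp_eq_eqToIso p q))))
      (.comp (.whiskerRight (.of_eq (V.mapComp_eq_eqToIso p q)) _)
        (.comp (.associator _ _ _) (.comp (.whiskerLeft _ (.eqToHom _))
          (.comp (.associator_inv _ _ _)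
            (.comp (.whiskerRight (.eqToHom _) _) (.associator _ _ _)))))))

lemma toTrans_isMarked (c : WeightedCocone V F U) (S : MorphismProperty Bᵒᵖ) :
    IsMarked S V (homInto F U) c.toTrans := fun _ _ p _ =>
  ⟨c.fn_square p.unop, rfl⟩

/-- The elementary data of a `2`-natural transformation `V ⟶ C(F(-), U)`. -/
def ofTrans (σ : oplax V ⟶ oplax (homInto F U)) (hσ : IsMarked ⊤ V (homInto F U) σ) :
    WeightedCocone V F U where
  fn b := (σ.app (op b)).toFunctor
  fn_obj {a b} f x := ((hσ f.op trivial).app x).1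
  fn_map {a b} f {x y} t := by
    obtain ⟨h, -⟩ := hσ f.op trivial
    have h' := congrArg Cat.Hom.toFunctor h
    exact Functor.hcongr_hom h' t
  fn_map₂ {a b f g} δ x := by
    have h := σ.naturality_naturality (op2 δ)
    obtain ⟨e, he⟩ := hσ f.op trivial
    obtain ⟨e', he'⟩ := hσ g.op trivial
    rw [he, he'] at h
    -- The marking turns both structure cells of the 2-cell law into `eqToHom`s, which are then
    -- discarded.
    have h₁ : (oplax V).map₂ (op2 δ) ▷ σ.app (op a) ≍
        σ.app (op b) ◁ (oplax (homInto F U)).map₂ (op2 δ) :=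
      (comp_eqToHom_heq _ e').symm.trans ((heq_of_eq h).trans (eqToHom_comp_heq _ e))
    exact cat_app_heq e e' h₁ x

/-- Structure cells that are identities carry no information, so the components determine the
transformation. -/
lemma trans_ext {σ τ : oplax V ⟶ oplax (homInto F U)} (hσ : IsMarked ⊤ V (homInto F U) σ)
    (hτ : IsMarked ⊤ V (homInto F U) τ)
    (h : ∀ b, (ofTrans σ hσ).fn b = (ofTrans τ hτ).fn b) : σ = τ := by
  have e : ∀ X, σ.app X = τ.app X := fun X => Cat.ext (h X.unop)
  exact oplaxTrans_ext e fun p => IsIdCell.heq (hσ p trivial) (hτ p trivial) (by rw [e])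

/-- A morphism of weighted cocones, as a modification. -/
def homMk {σ τ : oplax V ⟶ oplax (homInto F U)} (hσ : IsMarked ⊤ V (homInto F U) σ)
    (hτ : IsMarked ⊤ V (homInto F U) τ)
    (m : ∀ b, (ofTrans σ hσ).fn b ⟶ (ofTrans τ hτ).fn b)
    (hm : ∀ {a b : B} (f : a ⟶ b) (x : V.obj (op b)),
      (m a).app ((V.map f.op).toFunctor.obj x) ≍ F.map f ◁ (m b).app x) :
    σ ⟶ τ :=
  ⟨⟨fun X => Cat.Hom₂.ofNatTrans (m X.unop), fun p => by
    obtain ⟨e, he⟩ := hσ p trivial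
    obtain ⟨e', he'⟩ := hτ p trivial
    rw [he, he']
    apply eq_of_heq
    refine (comp_eqToHom_heq _ _).trans (HEq.trans ?_ (eqToHom_comp_heq _ _).symm)
    exact cat_heq_of_app e e' fun x => hm p.unop x⟩⟩

/-- The modification axiom, once the structure cells of `σ` and `τ` are recognized as identities. -/
lemma hom_app_map {σ τ : oplax V ⟶ oplax (homInto F U)} (hσ : IsMarked ⊤ V (homInto F U) σ)
    (hτ : IsMarked ⊤ V (homInto F U) τ) (Γ : σ ⟶ τ) {a b : B} (f : a ⟶ b) (x : V.obj (op b)) :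
    (Γ.as.app (op a)).toNatTrans.app ((V.map f.op).toFunctor.obj x) ≍
      F.map f ◁ (show (ofTrans σ hσ).fn b ⟶ (ofTrans τ hτ).fn b from
        (Γ.as.app (op b)).toNatTrans).app x := by
  have h := Γ.as.naturality f.op
  obtain ⟨e, he⟩ := hσ f.op trivial
  obtain ⟨e', he'⟩ := hτ f.op trivial
  rw [he, he'] at h
  exact cat_app_heq e e' ((comp_eqToHom_heq _ e').symm.trans
    ((heq_of_eq h).trans (eqToHom_comp_heq _ e))) x

end WeightedCocone

end

/-! ### From weighted cocones to oplax cones -/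

section

variable {B : Type u} [Bicategory.{u, u} B] [Bicategory.Strict B]
  {B' : Type u} [Bicategory.{u, u} B'] [Bicategory.Strict B']
  {C : Type u₁} [Bicategory.{u, u} C] [Bicategory.Strict C]

/-- An oplax natural transformation from the constant `2`-functor at `1` to the restriction of `V`
along `P`, in elementary terms. -/
structure OplaxSection (P : StrictPseudofunctor B' B) (V : StrictPseudofunctor Bᵒᵖ Cat.{u, u}) where
  pt (X : B') : V.obj (op (P.obj X))
  arr {X Y : B'} (p : X ⟶ Y) : pt X ⟶ (V.map (P.map p).op).toFunctor.obj (pt Y)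
  arr_map₂ {X Y : B'} {p q : X ⟶ Y} (δ : p ⟶ q) :
    arr p ≫ (V.map₂ (op2 (P.map₂ δ))).toNatTrans.app (pt Y) = arr q
  arr_id (X : B') : ∃ e, arr (𝟙 X) = eqToHom e
  arr_comp {X Y Z : B'} (p : X ⟶ Y) (q : Y ⟶ Z) :
    arr (p ≫ q) ≍ arr p ≫ (V.map (P.map p).op).toFunctor.map (arr q)

omit [Bicategory.Strict B] in
lemma OplaxSection.map_comp_obj {P : StrictPseudofunctor B' B}
    {V : StrictPseudofunctor Bᵒᵖ Cat.{u, u}} {X Y Z : B'} (p : X ⟶ Y) (q : Y ⟶ Z)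
    (x : V.obj (op (P.obj Z))) :
    (V.map (P.map (p ≫ q)).op).toFunctor.obj x =
      (V.map (P.map p).op).toFunctor.obj ((V.map (P.map q).op).toFunctor.obj x) := by
  rw [P.map_comp]
  exact congrArg (fun k : V.obj _ ⟶ V.obj _ => k.toFunctor.obj x)
    (V.map_comp (P.map q).op (P.map p).op)

namespace OplaxSection

variable {P : StrictPseudofunctor B' B} {V : StrictPseudofunctor Bᵒᵖ Cat.{u, u}}
  (s : OplaxSection P V) {F : StrictPseudofunctor B C} {U : C}

/-- The structure `2`-cells of the cone obtained from a weighted cocone. -/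
def coneCell (w : WeightedCocone V F U) {X Y : B'} (p : X ⟶ Y) :
    (w.fn (P.obj X)).obj (s.pt X) ⟶ F.map (P.map p) ≫ (w.fn (P.obj Y)).obj (s.pt Y) :=
  (w.fn (P.obj X)).map (s.arr p) ≫ eqToHom (w.fn_obj (P.map p) (s.pt Y))

lemma coneCell_heq (w : WeightedCocone V F U) {X Y : B'} (p : X ⟶ Y) :
    s.coneCell w p ≍ (w.fn (P.obj X)).map (s.arr p) :=
  comp_eqToHom_heq _ _

/-- Apply `w` to the 2-cell law of the section; the factor `V(δ)` becomes `F(δ)` by the 2-naturality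
of `w`. -/
lemma coneCell_map₂ (w : WeightedCocone V F U) {X Y : B'} {p q : X ⟶ Y} (δ : p ⟶ q) :
    s.coneCell w p ≫ F.map₂ (P.map₂ δ) ▷ (w.fn (P.obj Y)).obj (s.pt Y) = s.coneCell w q := by
  apply eq_of_heq
  refine HEq.trans ?_ (s.coneCell_heq w q).symm
  rw [← s.arr_map₂ δ, Functor.map_comp]
  exact comp_heq rfl (w.fn_obj _ _).symm (w.fn_obj _ _).symm (s.coneCell_heq w p)
    (w.fn_map₂ (P.map₂ δ) (s.pt Y)).symm

lemma isIdCell_coneCell (w : WeightedCocone V F U) {X Y : B'} (p : X ⟶ Y)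
    (h : ∃ e, s.arr p = eqToHom e) : IsIdCell (s.coneCell w p) := by
  obtain ⟨e, he⟩ := h
  refine ⟨(congrArg (w.fn (P.obj X)).obj e).trans (w.fn_obj _ _), ?_⟩
  rw [coneCell, he, eqToHom_map, eqToHom_trans]

/-- Apply `w` to the composition law of the section; naturality of `w` in 1-cells turns the action
of `V` on the second arrow into whiskering by the image under `F`. -/
lemma coneCell_comp (w : WeightedCocone V F U) {X Y Z : B'} (p : X ⟶ Y) (q : Y ⟶ Z) :
    s.coneCell w (p ≫ q) ≍ s.coneCell w p ≫ F.map (P.map p) ◁ s.coneCell w q := by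
  refine (s.coneCell_heq w _).trans
    ((functor_map_heq rfl rfl (map_comp_obj _ _ _) (s.arr_comp p q)).trans ?_)
  rw [Functor.map_comp]
  exact comp_heq rfl (w.fn_obj _ _) ((w.fn_obj _ _).trans (by rw [w.fn_obj]))
    (s.coneCell_heq w p).symm
    ((w.fn_map _ _).trans (whiskerLeft_heq rfl rfl (w.fn_obj _ _) (s.coneCell_heq w q).symm))

/-- The oplax cone obtained by evaluating a weighted cocone at a section of the weight. -/
def cone (w : WeightedCocone V F U) : OplaxCone (P.comp F) U where
  leg X := (w.fn (P.obj X)).obj (s.pt X)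
  cell p := s.coneCell w p
  cell_map₂ δ := s.coneCell_map₂ w δ
  cell_id X := s.isIdCell_coneCell w _ (s.arr_id X)
  cell_comp p q := s.coneCell_comp w p q

lemma cone_toTrans_isMarked {S : MorphismProperty B'ᵒᵖ}
    (hs : ∀ {X Y : B'} (p : X ⟶ Y), S p.op → ∃ e, s.arr p = eqToHom e)
    (w : WeightedCocone V F U) : IsMarked S (constOne _) (homInto (P.comp F) U) (s.cone w).toTrans :=
  fun _ _ p hp => .of_app _ fun _ => s.isIdCell_coneCell w p.unop (hs p.unop hp)

/-- The components of the morphism of cones induced by a morphism of weighted cocones. -/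
def coneHomApp {σ τ : Cocones ⊤ V F U} (Γ : σ ⟶ τ) (X : B') :
    (s.cone (.ofTrans σ.obj σ.property)).leg X ⟶ (s.cone (.ofTrans τ.obj τ.property)).leg X :=
  (Γ.hom.as.app (op (P.obj X))).toNatTrans.app (s.pt X)

lemma coneHomApp_naturality {σ τ : Cocones ⊤ V F U} (Γ : σ ⟶ τ) {X Y : B'} (p : X ⟶ Y) :
    s.coneHomApp Γ X ≫ s.coneCell (.ofTrans τ.obj τ.property) p =
      s.coneCell (.ofTrans σ.obj σ.property) p ≫ F.map (P.map p) ◁ s.coneHomApp Γ Y := by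
  have h := (Γ.hom.as.app (op (P.obj X))).toNatTrans.naturality (s.arr p)
  have h' := WeightedCocone.hom_app_map σ.property τ.property Γ.hom (P.map p) (s.pt Y)
  apply eq_of_heq
  refine HEq.trans (comp_heq rfl rfl (WeightedCocone.fn_obj _ _ _).symm HEq.rfl
    (s.coneCell_heq _ p)) ((heq_of_eq h.symm).trans ?_)
  exact comp_heq rfl (WeightedCocone.fn_obj (.ofTrans σ.obj σ.property) _ _)
    (WeightedCocone.fn_obj (.ofTrans τ.obj τ.property) _ _)
    (s.coneCell_heq (.ofTrans σ.obj σ.property) p).symm h'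

/-- The functor from weighted cocones to marked oplax cones induced by a section of the weight. -/
def functor {S : MorphismProperty B'ᵒᵖ}
    (hs : ∀ {X Y : B'} (p : X ⟶ Y), S p.op → ∃ e, s.arr p = eqToHom e)
    (F : StrictPseudofunctor B C) (U : C) :
    Cocones ⊤ V F U ⥤ Cocones S (constOne B'ᵒᵖ) (P.comp F) U where
  obj σ := ⟨(s.cone (.ofTrans σ.obj σ.property)).toTrans, s.cone_toTrans_isMarked hs _⟩
  map {σ τ} Γ := ObjectProperty.homMk (OplaxCone.homMk (fun X => s.coneHomApp Γ X)
    fun p => s.coneHomApp_naturality Γ p)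
  map_id σ := ObjectProperty.hom_ext _ (OplaxCone.hom_ext fun X => rfl)
  map_comp Γ Θ := ObjectProperty.hom_ext _ (OplaxCone.hom_ext fun X => rfl)

lemma functor_coconesMap_obj {S : MorphismProperty B'ᵒᵖ}
    (hs : ∀ {X Y : B'} (p : X ⟶ Y), S p.op → ∃ e, s.arr p = eqToHom e)
    (F : StrictPseudofunctor B C) {U U' : C} (k : U ⟶ U') (σ : Cocones ⊤ V F U) :
    (s.functor hs F U').obj ((coconesMap ⊤ V F k).obj σ) =
      (coconesMap S (constOne _) (P.comp F) k).obj ((s.functor hs F U).obj σ) := by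
  refine ObjectProperty.FullSubcategory.ext (OplaxCone.trans_ext (fun X => rfl) fun {X Y} p => ?_)
  refine (s.coneCell_heq _ p).trans ?_
  -- The right side is the structure cell of the composite with `homIntoMap`: apart from the
  -- whiskered cone cell it consists of identities in `Cat` and one associator of `C`, itself an
  -- identity cell.
  change (WeightedCocone.fn (.ofTrans σ.obj σ.property) (P.obj X)).map (s.arr p) ▷ k ≍
    𝟙 _ ≫ s.coneCell (.ofTrans σ.obj σ.property) p ▷ k ≫ 𝟙 _ ≫
      (α_ (F.map (P.map p)) ((WeightedCocone.fn (.ofTrans σ.obj σ.property) (P.obj Y)).obj (s.pt Y))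
        k).hom ≫ 𝟙 _
  rw [Category.id_comp, Category.id_comp, Category.comp_id]
  refine HEq.trans ?_ (IsIdCell.heq_comp _ (.associator _ _ _)).symm
  exact whiskerRight_heq rfl rfl (WeightedCocone.fn_obj (.ofTrans σ.obj σ.property) _ _)
    (s.coneCell_heq (.ofTrans σ.obj σ.property) p).symm

end OplaxSection

namespace OplaxCone

variable {F : StrictPseudofunctor B C} {U : C} {S : MorphismProperty Bᵒᵖ}

lemma cocones_heq {σ τ σ' τ' : Cocones S (constOne Bᵒᵖ) F U} (h : σ = σ') (h' : τ = τ')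
    {Γ : σ ⟶ τ} {Γ' : σ' ⟶ τ'} (e : ∀ X, homApp Γ.hom X ≍ homApp Γ'.hom X) : Γ ≍ Γ' := by
  subst h h'
  exact heq_of_eq (ObjectProperty.hom_ext _ (hom_ext fun X => eq_of_heq (e X)))

end OplaxCone

namespace OplaxSection

variable {P : StrictPseudofunctor B' B} {V : StrictPseudofunctor Bᵒᵖ Cat.{u, u}}
  (s : OplaxSection P V) {F : StrictPseudofunctor B C} {U : C}

lemma functor_comp_coconesMap {S : MorphismProperty B'ᵒᵖ}
    (hs : ∀ {X Y : B'} (p : X ⟶ Y), S p.op → ∃ e, s.arr p = eqToHom e)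
    (F : StrictPseudofunctor B C) {U U' : C} (k : U ⟶ U') :
    coconesMap ⊤ V F k ⋙ s.functor hs F U' =
      s.functor hs F U ⋙ coconesMap S (constOne _) (P.comp F) k :=
  CategoryTheory.Functor.hext (s.functor_coconesMap_obj hs F k) fun σ τ Γ =>
    OplaxCone.cocones_heq (s.functor_coconesMap_obj hs F k σ) (s.functor_coconesMap_obj hs F k τ)
      -- At `X` both sides are the value of `Γ` at the point of the section, whiskered with `k`.
      fun X => HEq.rfl

/-- If evaluation at a section of the weight is fully faithful and bijective on objects, it is an
isomorphism of categories, `2`-natural in the vertex. -/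
noncomputable def coconesIso {S : MorphismProperty B'ᵒᵖ}
    (hs : ∀ {X Y : B'} (p : X ⟶ Y), S p.op → ∃ e, s.arr p = eqToHom e)
    (F : StrictPseudofunctor B C) (hff : ∀ U : C, (s.functor hs F U).FullyFaithful)
    (hi : ∀ U : C, Function.Injective (s.functor hs F U).obj)
    (hsurj : ∀ U : C, Function.Surjective (s.functor hs F U).obj) :
    CoconesIso ⊤ V F S (constOne _) (P.comp F) where
  iso U := catIsoOfBijective (s.functor hs F U) (hff U) (hi U) (hsurj U)
  naturality k := Cat.ext (s.functor_comp_coconesMap hs F k)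
  naturality₂ {U U' k l} κ := cat_heq_of_app (Cat.ext (s.functor_comp_coconesMap hs F k))
    (Cat.ext (s.functor_comp_coconesMap hs F l)) fun σ =>
      OplaxCone.cocones_heq (s.functor_coconesMap_obj hs F k σ) (s.functor_coconesMap_obj hs F l σ)
        -- At `X` both sides are the leg of the evaluated cone whiskered with `κ`.
        fun X => HEq.rfl

end OplaxSection

end

/-! ### Vertical and cartesian morphisms of the `2`-category of elements -/

section

variable {A : Type u} [Bicategory.{u, u} A]

lemma mapId_inv_app (W : StrictPseudofunctor A Cat.{u, u}) (b : A) (y : W.obj b) :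
    (W.mapId b).inv.toNatTrans.app y =
      eqToHom (congrArg (fun k : W.obj b ⟶ W.obj b => k.toFunctor.obj y) (W.map_id b).symm) := by
  rw [W.mapId_eq_eqToIso]
  exact Cat.eqToHom_app _ _ (W.map_id b).symm _

lemma map_id_map_heq (W : StrictPseudofunctor A Cat.{u, u}) (b : A) {x y : W.obj b} (t : x ⟶ y) :
    (W.map (𝟙 b)).toFunctor.map t ≍ t :=
  Functor.hcongr_hom (congrArg Cat.Hom.toFunctor (W.map_id b)) t

lemma map_id_obj (W : StrictPseudofunctor A Cat.{u, u}) (b : A) (x : W.obj b) :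
    (W.map (𝟙 b)).toFunctor.obj x = x :=
  congrArg (fun k : W.obj b ⟶ W.obj b => k.toFunctor.obj x) (W.map_id b)

end

variable {A : Type u} [Bicategory.{u, u} A] [Bicategory.Strict A]

namespace Elements

variable {W : StrictPseudofunctor Aᵒᵖ Cat.{u, u}}

lemma hom_ext {X Y : Elements W} {p q : X ⟶ Y} (h : p.base = q.base) (h' : p.fiber ≍ q.fiber) :
    p = q := by
  obtain ⟨f, α⟩ := p
  obtain ⟨g, β⟩ := q
  obtain rfl : f = g := h
  obtain rfl : α = β := eq_of_heq h'
  rfl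

lemma hom₂_heq {X Y : Elements W} {p q p' q' : X ⟶ Y} (h : p = p') (h' : q = q') {η : p ⟶ q}
    {θ : p' ⟶ q'} (e : Hom₂.cell η ≍ Hom₂.cell θ) : η ≍ θ := by
  subst h h'
  exact heq_of_eq (Hom₂.ext (eq_of_heq e))

lemma comp_fiber_heq {X Y Z : Elements W} (p : X ⟶ Y) (q : Y ⟶ Z) :
    (p ≫ q).fiber ≍ p.fiber ≫ (W.map p.base.op).toFunctor.map q.fiber := by
  change p.fiber ≫ (W.map p.base.op).toFunctor.map q.fiber ≫
    (W.mapComp q.base.op p.base.op).inv.toNatTrans.app Z.fiber ≍ _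
  rw [mapComp_inv_app]
  exact comp_heq rfl rfl
    (congrArg (fun k : W.obj _ ⟶ W.obj _ => k.toFunctor.obj _) (W.map_comp q.base.op p.base.op))
    HEq.rfl (comp_eqToHom_heq _ _)

/-- The vertical morphism `(id, α)`. -/
def vert {a : A} {x y : W.obj (op a)} (α : x ⟶ y) : (⟨a, x⟩ : Elements W) ⟶ ⟨a, y⟩ :=
  ⟨𝟙 a, α ≫ (W.mapId (op a)).inv.toNatTrans.app y⟩

/-- The cartesian morphism `(f, id)`. -/
def cart {a b : A} (f : a ⟶ b) (y : W.obj (op b)) :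
    (⟨a, (W.map f.op).toFunctor.obj y⟩ : Elements W) ⟶ ⟨b, y⟩ :=
  ⟨f, 𝟙 _⟩

lemma cart_marked {a b : A} (f : a ⟶ b) (y : W.obj (op b)) : cartesianMarking W (cart f y).op :=
  ⟨rfl, rfl⟩

lemma vert_fiber_heq {a : A} {x y : W.obj (op a)} (α : x ⟶ y) : (vert α).fiber ≍ α := by
  change α ≫ (W.mapId (op a)).inv.toNatTrans.app y ≍ α
  rw [mapId_inv_app]
  exact comp_eqToHom_heq _ _

lemma vert_id {a : A} (x : W.obj (op a)) : vert (𝟙 x) = 𝟙 (⟨a, x⟩ : Elements W) :=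
  hom_ext rfl (heq_of_eq (Category.id_comp _))

lemma vert_comp_fiber_heq {a : A} {x y : W.obj (op a)} {Z : Elements W} (α : x ⟶ y)
    (q : (⟨a, y⟩ : Elements W) ⟶ Z) : (vert α ≫ q).fiber ≍ α ≫ q.fiber :=
  (comp_fiber_heq _ _).trans (comp_heq rfl (map_id_obj W _ _) (map_id_obj W _ _)
    (vert_fiber_heq α) (map_id_map_heq W _ _))

lemma comp_vert_fiber_heq {a : A} {x y : W.obj (op a)} {X : Elements W}
    (p : X ⟶ (⟨a, x⟩ : Elements W)) (γ : x ⟶ y) :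
    (p ≫ vert γ).fiber ≍ p.fiber ≫ (W.map p.base.op).toFunctor.map γ :=
  (comp_fiber_heq _ _).trans (comp_heq rfl rfl
    (congrArg (W.map p.base.op).toFunctor.obj (map_id_obj W _ _)) HEq.rfl
    (functor_map_heq rfl rfl (map_id_obj W _ _) (vert_fiber_heq γ)))

lemma comp_cart_fiber_heq {a b : A} (f : a ⟶ b) (y : W.obj (op b)) {X : Elements W}
    (p : X ⟶ (⟨a, (W.map f.op).toFunctor.obj y⟩ : Elements W)) :
    (p ≫ cart f y).fiber ≍ p.fiber := by
  refine (comp_fiber_heq _ _).trans (heq_of_eq ?_)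
  exact (congrArg (p.fiber ≫ ·) ((W.map p.base.op).toFunctor.map_id _)).trans (Category.comp_id _)

lemma cart_comp_fiber_heq {a b : A} (f : a ⟶ b) (y : W.obj (op b)) {Z : Elements W}
    (q : (⟨b, y⟩ : Elements W) ⟶ Z) :
    (cart f y ≫ q).fiber ≍ (W.map f.op).toFunctor.map q.fiber :=
  (comp_fiber_heq _ _).trans (heq_of_eq (Category.id_comp _))

lemma vert_comp {a : A} {x y z : W.obj (op a)} (α : x ⟶ y) (β : y ⟶ z) :
    vert (W := W) α ≫ vert β = vert (α ≫ β) :=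
  hom_ext (Bicategory.Strict.id_comp _) ((vert_comp_fiber_heq _ _).trans
    ((comp_heq rfl rfl (map_id_obj W _ _) HEq.rfl (vert_fiber_heq β)).trans
      (vert_fiber_heq _).symm))

/-- Both sides lie over `p.base` and have the same fibre part. On the left the vertical factor is
given by the image of `γ` under `cosliceMap p`; this is what makes the formula for coslice cocones
natural. -/
lemma vert_comp_cart {X Y : Elements W} (p : X ⟶ Y) {t : W.obj (op Y.base)} (γ : Y.fiber ⟶ t) :
    vert (p.fiber ≫ (W.map p.base.op).toFunctor.map γ) ≫ cart p.base t =
      p ≫ vert (a := Y.base) γ :=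
  hom_ext ((Bicategory.Strict.id_comp _).trans (Bicategory.Strict.comp_id _).symm)
    ((comp_cart_fiber_heq _ _ _).trans ((vert_fiber_heq _).trans (comp_vert_fiber_heq _ _).symm))

/-- The vertical–cartesian factorization, which reduces a marked cone to its vertical cells. -/
lemma vert_fiber_comp_cart {X Y : Elements W} (p : X ⟶ Y) :
    vert (a := X.base) p.fiber ≫ cart p.base Y.fiber = p :=
  hom_ext (Bicategory.Strict.id_comp _) ((comp_cart_fiber_heq _ _ _).trans (vert_fiber_heq _))

lemma vert_map_comp_cart {a b : A} (f : a ⟶ b) {y z : W.obj (op b)} (β : y ⟶ z) :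
    vert ((W.map f.op).toFunctor.map β) ≫ cart f z = cart f y ≫ vert β :=
  hom_ext ((Bicategory.Strict.id_comp _).trans (Bicategory.Strict.comp_id _).symm)
    ((comp_cart_fiber_heq _ _ _).trans ((vert_fiber_heq _).trans
      ((functor_map_heq rfl rfl (map_id_obj W _ _) (vert_fiber_heq β)).symm.trans
        (cart_comp_fiber_heq _ _ _).symm)))

/-- The morphism `(g, W(δ)_y)`. -/
def shift {a b : A} {f g : a ⟶ b} (δ : f ⟶ g) (y : W.obj (op b)) :
    (⟨a, (W.map f.op).toFunctor.obj y⟩ : Elements W) ⟶ ⟨b, y⟩ :=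
  ⟨g, (W.map₂ (op2 δ)).toNatTrans.app y⟩

/-- The `2`-cell `(f, id) ⟶ (g, W(δ)_y)` given by `δ`. -/
def shiftCell {a b : A} {f g : a ⟶ b} (δ : f ⟶ g) (y : W.obj (op b)) : cart f y ⟶ shift δ y :=
  (⟨δ, Category.id_comp _⟩ : Hom₂ (cart f y) (shift δ y))

/-- Naturality of `W(δ)` at `γ` moves it past `γ`, after which the defining condition of the 2-cell
`δ` turns `p.fiber` into `q.fiber`. -/
lemma vert_comp_shift {X Y : Elements W} {p q : X ⟶ Y} (δ : p ⟶ q) {t : W.obj (op Y.base)}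
    (γ : Y.fiber ⟶ t) :
    vert (p.fiber ≫ (W.map p.base.op).toFunctor.map γ) ≫ shift (Hom₂.cell δ) t =
      q ≫ vert (a := Y.base) γ := by
  refine hom_ext ((Bicategory.Strict.id_comp _).trans (Bicategory.Strict.comp_id _).symm)
    ((vert_comp_fiber_heq _ _).trans (HEq.trans (heq_of_eq ?_) (comp_vert_fiber_heq _ _).symm))
  have h := (W.map₂ (op2 (Hom₂.cell δ))).toNatTrans.naturality γ
  have hw := Hom₂.w δ
  change (p.fiber ≫ (W.map p.base.op).toFunctor.map γ) ≫
    (W.map₂ (op2 (Hom₂.cell δ))).toNatTrans.app t =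
    q.fiber ≫ (W.map q.base.op).toFunctor.map γ
  rw [← hw, Category.assoc, Category.assoc]
  exact congrArg _ h

end Elements

/-! ### Cartesian-marked oplax cones -/

namespace OplaxCone

open Elements

variable {C : Type u₁} [Bicategory.{u, u} C] [Bicategory.Strict C]
  {W : StrictPseudofunctor Aᵒᵖ Cat.{u, u}} {G : StrictPseudofunctor (Elements W) C} {U : C}

lemma isIdCell_cell_cart (σ : Cocones (cartesianMarking W) (constOne _) G U) {a b : A} (f : a ⟶ b)
    (y : W.obj (op b)) : IsIdCell ((ofTrans σ.obj).cell (cart f y)) :=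
  (σ.property _ (cart_marked f y)).app _

/-- On a cartesian morphism the cells of both cones are identities, so the modification axiom
becomes the strict compatibility required of a morphism of weighted cocones. -/
lemma homApp_cart_heq {σ τ : Cocones (cartesianMarking W) (constOne _) G U} (Γ : σ ⟶ τ) {a b : A}
    (f : a ⟶ b) (y : W.obj (op b)) :
    homApp Γ.hom ⟨a, (W.map f.op).toFunctor.obj y⟩ ≍ G.map (cart f y) ◁ homApp Γ.hom ⟨b, y⟩ :=
  (IsIdCell.heq_comp _ (isIdCell_cell_cart τ f y)).symm.trans
    ((heq_of_eq (homApp_naturality Γ.hom (cart f y))).trans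
      (IsIdCell.comp_heq _ (isIdCell_cell_cart σ f y)))

variable (c : OplaxCone G U)

lemma cell_heq {X Y : Elements W} {p q : X ⟶ Y} (h : p = q) : c.cell p ≍ c.cell q := by
  rw [h]

lemma isIdCell_cell_vert_id {a : A} (x : W.obj (op a)) : IsIdCell (c.cell (vert (𝟙 x))) :=
  (c.cell_id _).of_heq rfl (by rw [vert_id]) (c.cell_heq (vert_id x).symm)

lemma cell_vert_comp_heq {a : A} {x y z : W.obj (op a)} (α : x ⟶ y) (β : y ⟶ z) :
    c.cell (vert (α ≫ β)) ≍ c.cell (vert α) ≫ G.map (vert α) ◁ c.cell (vert β) :=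
  (c.cell_heq (vert_comp α β).symm).trans (c.cell_comp _ _)

variable {c} (hc : ∀ {a b : A} (f : a ⟶ b) (y : W.obj (op b)), IsIdCell (c.cell (cart f y)))

include hc

lemma leg_cart {a b : A} (f : a ⟶ b) (y : W.obj (op b)) :
    c.leg ⟨a, (W.map f.op).toFunctor.obj y⟩ = G.map (cart f y) ≫ c.leg ⟨b, y⟩ :=
  (hc f y).1

lemma cell_comp_cart_heq {a b : A} (f : a ⟶ b) (y : W.obj (op b)) {X : Elements W}
    (p : X ⟶ (⟨a, (W.map f.op).toFunctor.obj y⟩ : Elements W)) :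
    c.cell (p ≫ cart f y) ≍ c.cell p :=
  (c.cell_comp _ _).trans (IsIdCell.heq_comp _ (.whiskerLeft _ (hc f y)))

/-- Factor `p` as vertical followed by cartesian; the cartesian factor contributes an identity cell.
-/
lemma cell_vert_fiber_heq {X Y : Elements W} (p : X ⟶ Y) :
    c.cell (vert (a := X.base) p.fiber) ≍ c.cell p :=
  (cell_comp_cart_heq hc _ _ _).symm.trans (c.cell_heq (vert_fiber_comp_cart p))

/-- Compute the cell of the common composite in `vert_map_comp_cart` in two ways; each time the
cartesian factor drops out. -/
lemma cell_vert_map_heq {a b : A} (f : a ⟶ b) {y z : W.obj (op b)} (β : y ⟶ z) :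
    c.cell (vert ((W.map f.op).toFunctor.map β)) ≍ G.map (cart f y) ◁ c.cell (vert β) :=
  (cell_comp_cart_heq hc _ _ _).symm.trans ((c.cell_heq (vert_map_comp_cart f β)).trans
    ((c.cell_comp _ _).trans (IsIdCell.comp_heq _ (hc f y))))

/-- The 2-cell `δ` lifts to one from the cartesian `(f, 1)`, where the cone is trivial, to `(g,
W(δ)_y)`, whose cell is that of its vertical part. Compatibility of the cone with this lift gives
the claim. -/
lemma cell_vert_map₂_heq {a b : A} {f g : a ⟶ b} (δ : f ⟶ g) (y : W.obj (op b)) :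
    c.cell (vert ((W.map₂ (op2 δ)).toNatTrans.app y)) ≍
      G.map₂ (shiftCell δ y) ▷ c.leg ⟨b, y⟩ :=
  (cell_vert_fiber_heq hc (shift δ y)).trans ((heq_of_eq (c.cell_map₂ (shiftCell δ y)).symm).trans
    (IsIdCell.comp_heq _ (hc f y)))

end OplaxCone

/-! ### Weighted colimits as cartesian-marked oplax conical colimits -/

section

open Elements

variable {A : Type u} [Bicategory.{u, u} A] [Bicategory.Strict A]
  {C : Type u₁} [Bicategory.{u, u} C] [Bicategory.Strict C]

/-- The tautological section of `W` over its `2`-category of elements. -/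
def tautSection (W : StrictPseudofunctor Aᵒᵖ Cat.{u, u}) : OplaxSection (proj W) W where
  pt X := X.fiber
  arr p := p.fiber
  arr_map₂ δ := Hom₂.w δ
  arr_id X := ⟨_, mapId_inv_app W (op X.base) X.fiber⟩
  arr_comp p q := comp_fiber_heq p q

variable {W : StrictPseudofunctor Aᵒᵖ Cat.{u, u}} {F : StrictPseudofunctor A C} {U : C}

lemma tautSection_marked {X Y : Elements W} (p : X ⟶ Y) (hp : cartesianMarking W p.op) :
    ∃ e, (tautSection W).arr p = eqToHom e := hp

lemma coneCell_vert_heq (w : WeightedCocone W F U) {a : A} {x y : W.obj (op a)} (t : x ⟶ y) :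
    (tautSection W).coneCell w (vert t) ≍ (w.fn a).map t :=
  ((tautSection W).coneCell_heq w (vert t)).trans
    (functor_map_heq rfl rfl (map_id_obj W _ _) (vert_fiber_heq t))

/-- The value of the weighted cocone associated to a marked cone on a morphism of `W a`. -/
def weightedMap (c : OplaxCone ((proj W).comp F) U) {a : A} {x y : W.obj (op a)} (t : x ⟶ y) :
    c.leg ⟨a, x⟩ ⟶ c.leg ⟨a, y⟩ :=
  c.cell (vert t) ≫ eqToHom (id_map_obj F (a := a) (c.leg ⟨a, y⟩))

lemma weightedMap_heq (c : OplaxCone ((proj W).comp F) U) {a : A} {x y : W.obj (op a)}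
    (t : x ⟶ y) : weightedMap c t ≍ c.cell (vert t) :=
  comp_eqToHom_heq _ _

/-- The functor on `W a` associated to a marked cone. -/
def weightedFn (c : OplaxCone ((proj W).comp F) U) (a : A) : W.obj (op a) ⥤ (F.obj a ⟶ U) where
  obj x := c.leg ⟨a, x⟩
  map t := weightedMap c t
  map_id x := eq_of_heq ((weightedMap_heq c _).trans
    ((c.isIdCell_cell_vert_id x).heq (.id _) rfl))
  map_comp α β := eq_of_heq ((weightedMap_heq c _).trans ((c.cell_vert_comp_heq α β).trans
    (comp_heq rfl (id_map_obj F _)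
      ((congrArg (F.map (𝟙 a) ≫ ·) (id_map_obj F _)).trans (id_map_obj F _))
      (weightedMap_heq c α).symm
      ((id_map_heq F _).trans (weightedMap_heq c β).symm))))

/-- The weighted cocone associated to a marked cone. -/
def weightedCocone (c : OplaxCone ((proj W).comp F) U)
    (hc : ∀ {a b : A} (f : a ⟶ b) (y : W.obj (op b)), IsIdCell (c.cell (cart f y))) :
    WeightedCocone W F U where
  fn a := weightedFn c a
  fn_obj f x := c.leg_cart hc f x
  fn_map {_ _} f {_ _} t := (weightedMap_heq c _).trans ((c.cell_vert_map_heq hc f t).trans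
    (whiskerLeft_heq rfl rfl (id_map_obj F _) (weightedMap_heq c t).symm))
  fn_map₂ δ x := (weightedMap_heq c _).trans (c.cell_vert_map₂_heq hc δ x)

lemma tautSection_functor_injective (U : C) :
    Function.Injective ((tautSection W).functor tautSection_marked F U).obj := by
  intro σ τ h
  have hleg : ∀ {a : A} (x : W.obj (op a)),
      (WeightedCocone.fn (.ofTrans σ.obj σ.property) a).obj x =
        (WeightedCocone.fn (.ofTrans τ.obj τ.property) a).obj x := fun {a} x =>
    congrArg (fun σ => (OplaxCone.ofTrans σ.obj).leg ⟨a, x⟩) h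
  have hcell : ∀ {X Y : Elements W} (p : X ⟶ Y),
      (tautSection W).coneCell (.ofTrans σ.obj σ.property) p ≍
        (tautSection W).coneCell (.ofTrans τ.obj τ.property) p := fun p =>
    congr_arg_heq (fun σ => (OplaxCone.ofTrans σ.obj).cell p) h
  refine ObjectProperty.FullSubcategory.ext (WeightedCocone.trans_ext σ.property τ.property
    fun a => CategoryTheory.Functor.hext hleg fun x y t => ?_)
  -- The action of a weighted cocone on `t` is the cell of its cone at the vertical morphism `(1,
  -- t)`.
  exact (coneCell_vert_heq _ t).symm.trans ((hcell (vert t)).trans (coneCell_vert_heq _ t))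

lemma tautSection_functor_surjective (U : C) :
    Function.Surjective ((tautSection W).functor tautSection_marked F U).obj := by
  intro σ
  have hc := fun {a b : A} (f : a ⟶ b) (y : W.obj (op b)) => OplaxCone.isIdCell_cell_cart σ f y
  refine ⟨⟨(weightedCocone (.ofTrans σ.obj) hc).toTrans, WeightedCocone.toTrans_isMarked _ _⟩,
    ObjectProperty.FullSubcategory.ext (OplaxCone.trans_ext (fun X => rfl) fun p => ?_)⟩
  -- The rebuilt cone has at `p` the cell of the vertical part of `p`, which is the cell of `p`
  -- itself since the given cone is marked.
  exact ((tautSection W).coneCell_heq (weightedCocone (.ofTrans σ.obj) hc) p).trans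
    ((weightedMap_heq _ _).trans (OplaxCone.cell_vert_fiber_heq hc p))

/-- The functor from weighted cocones to marked oplax cones is fully faithful. -/
noncomputable def tautSectionFullyFaithful (U : C) :
    ((tautSection W).functor tautSection_marked F U).FullyFaithful where
  preimage {σ τ} Γ := ObjectProperty.homMk (WeightedCocone.homMk σ.property τ.property
    (fun a =>
      { app := fun x => OplaxCone.homApp Γ.hom ⟨a, x⟩
        naturality := fun x y t => by
          have h := OplaxCone.homApp_naturality Γ.hom (vert t)
          apply eq_of_heq
          refine HEq.trans (comp_heq rfl (id_map_obj F _).symm (id_map_obj F _).symm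
            (coneCell_vert_heq (.ofTrans σ.obj σ.property) t).symm (id_map_heq F _).symm)
            ((heq_of_eq h.symm).trans (comp_heq rfl rfl (id_map_obj F _) HEq.rfl
              (coneCell_vert_heq (.ofTrans τ.obj τ.property) t))) })
    (fun f x => OplaxCone.homApp_cart_heq Γ f x))
  map_preimage Γ := ObjectProperty.hom_ext _ (OplaxCone.hom_ext fun X => rfl)
  preimage_map Γ := ObjectProperty.hom_ext _ (Oplax.OplaxTrans.homCategory.ext fun X =>
    Cat.Hom₂.ext (NatTrans.ext (funext fun x => rfl)))

variable (W F) in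
/-- Weighted cocones and cartesian-marked oplax cones agree. -/
noncomputable def weightedIsoMarked :
    CoconesIso ⊤ W F (cartesianMarking W) (constOne _) ((proj W).comp F) :=
  (tautSection W).coconesIso tautSection_marked F tautSectionFullyFaithful
    tautSection_functor_injective tautSection_functor_surjective

end

/-! ### Composition of a 2-functor with the identity -/

lemma strictPseudofunctor_ext {B : Type u₁} [Bicategory.{w₁, v₁} B] {C : Type u₂}
    [Bicategory.{w₂, v₂} C] {F G : StrictPseudofunctor B C}
    (h : F.toPrelaxFunctor = G.toPrelaxFunctor) : F = G := by
  obtain ⟨⟨⟨F₀, Fi, Fc, _, _, _, _, _⟩, _, hFi⟩, _, hFc⟩ := F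
  obtain ⟨⟨⟨G₀, Gi, Gc, _, _, _, _, _⟩, _, hGi⟩, _, hGc⟩ := G
  obtain rfl : F₀ = G₀ := h
  obtain rfl : @Fi = @Gi := funext fun a => (hFi a).trans (hGi a).symm
  obtain rfl : @Fc = @Gc := by
    funext a b c f g
    exact (hFc f g).trans (hGc f g).symm
  rfl

lemma id_comp_eq {B : Type u₁} [Bicategory.{w₁, v₁} B] {C : Type u₂} [Bicategory.{w₂, v₂} C]
    (F : StrictPseudofunctor B C) : (StrictPseudofunctor.id B).comp F = F :=
  strictPseudofunctor_ext rfl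

/-! ### Cartesian-marked oplax conical colimits as weighted colimits -/

section

open Elements

lemma natTrans_app_heq {X : Type u₁} [Category.{v₁} X] {Y : Type u₂} [Category.{v₂} Y]
    {G H : X ⥤ Y} (η : G ⟶ H) {x y : X} (h : x = y) : η.app x ≍ η.app y := by
  rw [h]

lemma under_hom_heq {X : Type u} [Category.{u} X] {x : X} {T T' V V' : Under x} (h : T = V)
    (h' : T' = V') {t : T ⟶ T'} {t' : V ⟶ V'} (e : t.right ≍ t'.right) : t ≍ t' := by
  subst h h'
  exact heq_of_eq (Under.UnderMorphism.ext (eq_of_heq e))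

variable {A : Type u} [Bicategory.{u, u} A] [Bicategory.Strict A]
  {C : Type u₁} [Bicategory.{u, u} C] [Bicategory.Strict C]

/-- The morphism of coslices `id ⟶ p.fiber`. -/
def cosliceArr {Z : StrictPseudofunctor Aᵒᵖ Cat.{u, u}} {X Y : Elements Z} (p : X ⟶ Y) :
    Under.mk (𝟙 X.fiber) ⟶ (cosliceMap p).obj (Under.mk (𝟙 Y.fiber)) :=
  Under.homMk p.fiber (by
    change 𝟙 _ ≫ p.fiber = p.fiber ≫ (Z.map p.base.op).toFunctor.map (𝟙 _)
    rw [CategoryTheory.Functor.map_id]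
    simp)

/-- The section of the weight `(b, x) ↦ x / Z(b)` given by the identities. -/
def cosliceSection (Z : StrictPseudofunctor Aᵒᵖ Cat.{u, u}) :
    OplaxSection (StrictPseudofunctor.id (Elements Z)) (cosliceWeight Z) where
  pt X := Under.mk (𝟙 X.fiber)
  arr p := cosliceArr p
  arr_map₂ δ := Under.UnderMorphism.ext (Hom₂.w δ)
  arr_id X := by
    have e : Under.mk (𝟙 X.fiber) = (cosliceMap (𝟙 X)).obj (Under.mk (𝟙 X.fiber)) :=
      (map_id_obj (cosliceWeight Z) (op X) (Under.mk (𝟙 X.fiber))).symm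
    refine ⟨e, Under.UnderMorphism.ext ?_⟩
    exact (mapId_inv_app Z (op X.base) X.fiber).trans (under_eqToHom_right e).symm
  arr_comp {X Y T} p q := under_hom_heq rfl
    (congrArg (fun k : (cosliceWeight Z).obj _ ⟶ (cosliceWeight Z).obj _ =>
      k.toFunctor.obj (Under.mk (𝟙 T.fiber))) ((cosliceWeight Z).map_comp q.op p.op))
    (comp_fiber_heq p q)

variable {Z : StrictPseudofunctor Aᵒᵖ Cat.{u, u}}

lemma cosliceSection_marked {X Y : Elements Z} (p : X ⟶ Y) (hp : cartesianMarking Z p.op) :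
    ∃ e, (cosliceSection Z).arr p = eqToHom e := by
  obtain ⟨h, e⟩ := hp
  change p.fiber = _ at e
  have e' : Under.mk (𝟙 X.fiber) = (cosliceMap p).obj (Under.mk (𝟙 Y.fiber)) := by
    refine under_ext _ _ h ?_
    change 𝟙 _ ≫ eqToHom h = p.fiber ≫ (Z.map p.base.op).toFunctor.map (𝟙 _)
    rw [CategoryTheory.Functor.map_id, Category.id_comp, Category.comp_id, e]
  refine ⟨e', Under.UnderMorphism.ext ?_⟩
  exact e.trans (under_eqToHom_right e').symm

/-- The vertical morphism given by an object of a coslice. -/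
abbrev underVert {X : Elements Z} (T : Under X.fiber) : X ⟶ ⟨X.base, T.right⟩ :=
  vert (a := X.base) T.hom

/-- The Yoneda step: every object of a coslice comes from an identity through the action of a
vertical morphism, so a 2-natural transformation out of the weight is determined by its values at
identities. -/
lemma cosliceMap_underVert_obj {X : Elements Z} (T : Under X.fiber) :
    (cosliceMap (underVert T)).obj (Under.mk (𝟙 T.right)) = T := by
  refine under_ext _ _ (map_id_obj Z (op X.base) T.right) (eq_of_heq ?_)
  refine (comp_eqToHom_heq _ _).trans ?_
  change (vert (a := X.base) T.hom).fiber ≫ (Z.map (𝟙 X.base : X.base ⟶ X.base).op).toFunctor.map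
    (𝟙 T.right) ≍ _
  rw [CategoryTheory.Functor.map_id]
  exact (heq_of_eq (Category.comp_id _)).trans (vert_fiber_heq T.hom)

lemma underVert_comp {X : Elements Z} {T T' : Under X.fiber} (t : T ⟶ T') :
    underVert T ≫ vert (a := X.base) t.right = underVert T' :=
  (vert_comp _ _).trans (by rw [Under.w t])

lemma cosliceMap_comp_obj {X Y T : Elements Z} (p : X ⟶ Y) (q : Y ⟶ T) (x : Under T.fiber) :
    (cosliceMap (p ≫ q)).obj x = (cosliceMap p).obj ((cosliceMap q).obj x) :=
  congrArg (fun k : (cosliceWeight Z).obj _ ⟶ (cosliceWeight Z).obj _ => k.toFunctor.obj x)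
    ((cosliceWeight Z).map_comp q.op p.op)

lemma cosliceMap_underVert_vert_obj {X : Elements Z} {T T' : Under X.fiber} (t : T ⟶ T') :
    (cosliceMap (underVert T)).obj ((cosliceMap (vert (a := X.base) t.right)).obj
      (Under.mk (𝟙 T'.right))) = T' := by
  refine (cosliceMap_comp_obj _ _ _).symm.trans ?_
  rw [underVert_comp]
  exact cosliceMap_underVert_obj T'

/-- The Yoneda step for morphisms: `t` is the image of an arrow of the tautological section under
the action of a vertical morphism. -/
lemma cosliceMap_underVert_map {X : Elements Z} {T T' : Under X.fiber} (t : T ⟶ T') :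
    (cosliceMap (underVert T)).map (cosliceArr (vert (a := X.base) t.right)) ≍ t := by
  refine under_hom_heq (cosliceMap_underVert_obj T) (cosliceMap_underVert_vert_obj t) ?_
  exact (map_id_map_heq Z (op X.base) _).trans (vert_fiber_heq t.right)

/-! ### Extending a marked cone to the coslices -/

section

variable {F : StrictPseudofunctor (Elements Z) C} {U : C}
  (c : OplaxCone F U)

lemma underVert_comp_leg {X : Elements Z} {T T' : Under X.fiber} (t : T ⟶ T') :
    F.map (underVert T) ≫ F.map (vert (a := X.base) t.right) ≫ c.leg ⟨X.base, T'.right⟩ =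
      F.map (underVert T') ≫ c.leg ⟨X.base, T'.right⟩ := by
  rw [← underVert_comp t]
  exact comp_map_obj F _ _ _

/-- The value on a morphism of a coslice of the weighted cocone associated to a marked cone. -/
def cosliceCoconeMap {X : Elements Z} {T T' : Under X.fiber} (t : T ⟶ T') :
    F.map (underVert T) ≫ c.leg ⟨X.base, T.right⟩ ⟶
      F.map (underVert T') ≫ c.leg ⟨X.base, T'.right⟩ :=
  F.map (underVert T) ◁ c.cell (vert (a := X.base) t.right) ≫ eqToHom (underVert_comp_leg c t)

lemma cosliceCoconeMap_heq {X : Elements Z} {T T' : Under X.fiber} (t : T ⟶ T') :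
    cosliceCoconeMap c t ≍ F.map (underVert T) ◁ c.cell (vert (a := X.base) t.right) :=
  comp_eqToHom_heq _ _

/-- The functor on a coslice associated to a marked cone. -/
def cosliceCoconeFn (X : Elements Z) : Under X.fiber ⥤ (F.obj X ⟶ U) where
  obj T := F.map (underVert T) ≫ c.leg ⟨X.base, T.right⟩
  map t := cosliceCoconeMap c t
  map_id T := eq_of_heq ((cosliceCoconeMap_heq c _).trans
    (((c.isIdCell_cell_vert_id T.right).whiskerLeft _).heq (.id _) rfl))
  map_comp {T T' T''} s t := by
    apply eq_of_heq
    refine (cosliceCoconeMap_heq c _).trans ?_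
    have h := whiskerLeft_heq (rfl : F.map (underVert T) = _) rfl
      ((congrArg (· ≫ c.leg ⟨X.base, T''.right⟩)
        (congrArg F.map (vert_comp s.right t.right).symm)).trans (comp_map_obj F _ _ _).symm)
      (c.cell_vert_comp_heq s.right t.right)
    refine h.trans ?_
    rw [Bicategory.whiskerLeft_comp]
    refine comp_heq rfl (underVert_comp_leg c s) ?_ (cosliceCoconeMap_heq c s).symm ?_
    · rw [comp_map_obj F (vert (a := X.base) s.right), vert_comp]
      exact underVert_comp_leg c (s ≫ t)
    · refine (comp_map_heq F _ _ _).trans (HEq.trans ?_ (cosliceCoconeMap_heq c t).symm)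
      rw [underVert_comp s]

lemma map₂_whiskerRight_congr (F : StrictPseudofunctor (Elements Z) C) {X Y : Elements Z}
    {p q p' q' : X ⟶ Y} (h : p = p') (h' : q = q') {η : p ⟶ q} {θ : p' ⟶ q'}
    (e : Hom₂.cell η ≍ Hom₂.cell θ) (x : F.obj Y ⟶ U) : F.map₂ η ▷ x ≍ F.map₂ θ ▷ x := by
  have := hom₂_heq h h' e
  subst h h'
  rw [eq_of_heq this]

section

variable {c} (hc : ∀ {a b : A} (f : a ⟶ b) (y : Z.obj (op b)), IsIdCell (c.cell (cart f y)))

include hc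

lemma cosliceCocone_fn_obj {X Y : Elements Z} (p : X ⟶ Y) (T : Under Y.fiber) :
    F.map (vert (a := X.base) (p.fiber ≫ (Z.map p.base.op).toFunctor.map T.hom)) ≫
      c.leg ⟨X.base, (Z.map p.base.op).toFunctor.obj T.right⟩ =
    F.map p ≫ F.map (underVert T) ≫ c.leg ⟨Y.base, T.right⟩ := by
  rw [c.leg_cart hc, comp_map_obj, vert_comp_cart, comp_map_obj]

lemma map_vert_comp_leg {a b : A} (f : a ⟶ b) {x y : Z.obj (op b)} (t : x ⟶ y) :
    F.map (vert ((Z.map f.op).toFunctor.map t)) ≫ c.leg ⟨a, (Z.map f.op).toFunctor.obj y⟩ =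
      F.map (cart f x) ≫ F.map (vert t) ≫ c.leg ⟨b, y⟩ := by
  rw [c.leg_cart hc, comp_map_obj, vert_map_comp_cart, comp_map_obj]

lemma map_vert_comp_leg_shift {a b : A} {f g : a ⟶ b} (δ : f ⟶ g) (y : Z.obj (op b)) :
    F.map (vert ((Z.map₂ (op2 δ)).toNatTrans.app y)) ≫ c.leg ⟨a, (Z.map g.op).toFunctor.obj y⟩ =
      F.map (shift δ y) ≫ c.leg ⟨b, y⟩ := by
  rw [c.leg_cart hc, comp_map_obj]
  exact congrArg (fun k => F.map k ≫ c.leg ⟨b, y⟩) (vert_fiber_comp_cart (shift δ y))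

lemma cosliceCocone_fn_map {X Y : Elements Z} (p : X ⟶ Y) {T T' : Under Y.fiber} (t : T ⟶ T') :
    F.map (vert (a := X.base) (p.fiber ≫ (Z.map p.base.op).toFunctor.map T.hom)) ◁
      c.cell (vert ((Z.map p.base.op).toFunctor.map t.right)) ≍
    F.map p ◁ F.map (underVert T) ◁ c.cell (vert (a := Y.base) t.right) := by
  refine (whiskerLeft_heq rfl (c.leg_cart hc _ _) (map_vert_comp_leg hc _ _)
    (c.cell_vert_map_heq hc p.base t.right)).trans ?_
  refine (comp_map_heq F _ _ _).trans (HEq.trans ?_ (comp_map_heq F _ _ _).symm)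
  rw [vert_comp_cart]

lemma cosliceCocone_fn_map₂ {X Y : Elements Z} {p q : X ⟶ Y} (δ : p ⟶ q) (T : Under Y.fiber) :
    F.map (vert (a := X.base) (p.fiber ≫ (Z.map p.base.op).toFunctor.map T.hom)) ◁
      c.cell (vert ((Z.map₂ (op2 (Hom₂.cell δ))).toNatTrans.app T.right)) ≍
    F.map₂ δ ▷ (F.map (underVert T) ≫ c.leg ⟨Y.base, T.right⟩) := by
  refine (whiskerLeft_heq rfl (c.leg_cart hc _ _) (map_vert_comp_leg_shift hc _ _)
    (c.cell_vert_map₂_heq hc (Hom₂.cell δ) T.right)).trans ?_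
  have h₁ := map₂_whiskerLeft_whiskerRight F
    (vert (a := X.base) (p.fiber ≫ (Z.map p.base.op).toFunctor.map T.hom))
    (shiftCell (Hom₂.cell δ) T.right) (c.leg ⟨Y.base, T.right⟩)
  have h₂ := map₂_whiskerRight_whiskerRight F δ (underVert T) (c.leg ⟨Y.base, T.right⟩)
  refine HEq.trans (HEq.trans ?_ (heq_of_eq h₁.symm)) (HEq.trans ?_ ((heq_of_eq h₂).trans ?_))
  · exact ((eqToHom_comp_heq _ _).trans (comp_eqToHom_heq _ _)).symm
  -- The two 2-cells of `∫Z` have parallel ends by the two factorizations, and both lie over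
  -- `Hom₂.cell δ` up to whiskering with an identity.
  · exact map₂_whiskerRight_congr F (vert_comp_cart p T.hom) (vert_comp_shift δ T.hom)
      ((id_whiskerLeft_heq (Hom₂.cell δ)).trans (whiskerRight_id_heq (Hom₂.cell δ)).symm) _
  · exact (eqToHom_comp_heq _ _).trans (comp_eqToHom_heq _ _)

end

/-- The weighted cocone associated to a marked cone. -/
def cosliceCocone (hc : ∀ {a b : A} (f : a ⟶ b) (y : Z.obj (op b)), IsIdCell (c.cell (cart f y))) :
    WeightedCocone (cosliceWeight Z) F U where
  fn X := cosliceCoconeFn c X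
  fn_obj p T := cosliceCocone_fn_obj hc p T
  fn_map {X Y} p T T' t := (cosliceCoconeMap_heq c ((cosliceMap p).map t)).trans
    ((cosliceCocone_fn_map hc p t).trans
      (whiskerLeft_heq rfl rfl (underVert_comp_leg c t) (cosliceCoconeMap_heq c t).symm))
  fn_map₂ {X Y p q} δ T := (cosliceCoconeMap_heq c ((cosliceMap₂ δ).app T)).trans
    (cosliceCocone_fn_map₂ hc δ T)

end

/-- The cone over `F` underlying a cone over the composite of the identity with `F`. -/
def OplaxCone.ofIdComp {B : Type u} [Bicategory.{u, u} B] [Bicategory.Strict B]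
    {F : StrictPseudofunctor B C} {U : C}
    (c : OplaxCone ((StrictPseudofunctor.id B).comp F) U) : OplaxCone F U where
  leg := c.leg
  cell := c.cell
  cell_map₂ := c.cell_map₂
  cell_id := c.cell_id
  cell_comp := c.cell_comp

variable {F : StrictPseudofunctor (Elements Z) C} {U : C}

/-- Naturality of `w` along `underVert T`, applied to an arrow of the section whose image there is
`t`; so the cells of the cone recover `w` on morphisms. -/
lemma coneCell_cosliceSection_heq (w : WeightedCocone (cosliceWeight Z) F U) {X : Elements Z}
    {T T' : Under X.fiber} (t : T ⟶ T') :
    F.map (underVert T) ◁ (cosliceSection Z).coneCell w (vert (a := X.base) t.right) ≍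
      (w.fn X).map t := by
  have h := w.fn_map (underVert T) (cosliceArr (vert (a := X.base) t.right))
  refine (whiskerLeft_heq rfl rfl (w.fn_obj _ _).symm
    ((cosliceSection Z).coneCell_heq w (vert (a := X.base) t.right))).trans (h.symm.trans ?_)
  exact functor_map_heq rfl (cosliceMap_underVert_obj T) (cosliceMap_underVert_vert_obj t)
    (cosliceMap_underVert_map t)

lemma cosliceSection_fn_obj (w : WeightedCocone (cosliceWeight Z) F U) {X : Elements Z}
    (T : Under X.fiber) : (w.fn X).obj T =
      F.map (underVert T) ≫ (w.fn ⟨X.base, T.right⟩).obj (Under.mk (𝟙 T.right)) :=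
  (congrArg (w.fn X).obj (cosliceMap_underVert_obj T).symm).trans (w.fn_obj _ _)

lemma cosliceSection_functor_injective (U : C) :
    Function.Injective ((cosliceSection Z).functor cosliceSection_marked F U).obj := by
  intro σ τ h
  have hleg : ∀ (X : Elements Z), (WeightedCocone.fn (.ofTrans σ.obj σ.property) X).obj
        (Under.mk (𝟙 X.fiber)) =
      (WeightedCocone.fn (.ofTrans τ.obj τ.property) X).obj (Under.mk (𝟙 X.fiber)) := fun X =>
    congrArg (fun ρ : Cocones (cartesianMarking Z) (constOne _)
      ((StrictPseudofunctor.id _).comp F) U =>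
      (OplaxCone.ofTrans ρ.obj).leg X) h
  have hcell : ∀ {X Y : Elements Z} (p : X ⟶ Y),
      (cosliceSection Z).coneCell (.ofTrans σ.obj σ.property) p ≍
        (cosliceSection Z).coneCell (.ofTrans τ.obj τ.property) p := fun p =>
    congr_arg_heq (fun ρ : Cocones (cartesianMarking Z) (constOne _)
      ((StrictPseudofunctor.id _).comp F) U =>
      (OplaxCone.ofTrans ρ.obj).cell p) h
  refine ObjectProperty.FullSubcategory.ext (WeightedCocone.trans_ext σ.property τ.property
    fun X => CategoryTheory.Functor.hext (fun T => ?_) fun T T' t => ?_)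
  · exact (cosliceSection_fn_obj _ T).trans ((congrArg (F.map (underVert T) ≫ ·) (hleg _)).trans
      (cosliceSection_fn_obj _ T).symm)
  · exact (coneCell_cosliceSection_heq _ t).symm.trans
      ((whiskerLeft_heq rfl (hleg _) (congrArg (F.map _ ≫ ·) (hleg _)) (hcell _)).trans
        (coneCell_cosliceSection_heq _ t))

lemma cosliceSection_functor_surjective (U : C) :
    Function.Surjective ((cosliceSection Z).functor cosliceSection_marked F U).obj := by
  intro σ
  have hc := fun {a b : A} (f : a ⟶ b) (y : Z.obj (op b)) => OplaxCone.isIdCell_cell_cart σ f y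
  refine ⟨⟨(cosliceCocone (OplaxCone.ofTrans σ.obj).ofIdComp hc).toTrans,
    WeightedCocone.toTrans_isMarked _ _⟩,
    ObjectProperty.FullSubcategory.ext (OplaxCone.trans_ext (fun X => ?_) fun {X Y} p => ?_)⟩
  -- The leg of the rebuilt cone is its value at the identity object of the coslice, whose vertical
  -- morphism is an identity.
  · exact (congrArg (fun k => F.map k ≫ (OplaxCone.ofTrans σ.obj).leg X) (vert_id X.fiber)).trans
      (id_map_obj F _)
  · refine ((cosliceSection Z).coneCell_heq (cosliceCocone (OplaxCone.ofTrans σ.obj).ofIdComp hc)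
      p).trans ((cosliceCoconeMap_heq (OplaxCone.ofTrans σ.obj).ofIdComp (cosliceArr p)).trans ?_)
    refine (whiskerLeft_heq (congrArg F.map (vert_id X.fiber)) rfl rfl HEq.rfl).trans
      ((id_map_heq F _).trans (OplaxCone.cell_vert_fiber_heq hc p))

/-! ### From morphisms of marked cones to morphisms of weighted cocones -/

section

variable {σ τ : Cocones ⊤ (cosliceWeight Z) F U}
  (Γ : ((cosliceSection Z).functor cosliceSection_marked F U).obj σ ⟶
    ((cosliceSection Z).functor cosliceSection_marked F U).obj τ)

/-- The morphism of weighted cocones underlying a morphism of marked cones, at an object of a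
coslice. -/
def cosliceHomApp {X : Elements Z} (T : Under X.fiber) :
    (WeightedCocone.fn (.ofTrans σ.obj σ.property) X).obj T ⟶
      (WeightedCocone.fn (.ofTrans τ.obj τ.property) X).obj T :=
  eqToHom (cosliceSection_fn_obj (.ofTrans σ.obj σ.property) T) ≫
    F.map (underVert T) ◁ OplaxCone.homApp Γ.hom ⟨X.base, T.right⟩ ≫
    eqToHom (cosliceSection_fn_obj (.ofTrans τ.obj τ.property) T).symm

lemma cosliceHomApp_heq {X : Elements Z} (T : Under X.fiber) :
    cosliceHomApp Γ T ≍ F.map (underVert T) ◁ OplaxCone.homApp Γ.hom ⟨X.base, T.right⟩ :=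
  (eqToHom_comp_heq _ _).trans (comp_eqToHom_heq _ _)

lemma cosliceHomApp_naturality {X : Elements Z} {T T' : Under X.fiber} (t : T ⟶ T') :
    (WeightedCocone.fn (.ofTrans σ.obj σ.property) X).map t ≫ cosliceHomApp Γ T' =
      cosliceHomApp Γ T ≫ (WeightedCocone.fn (.ofTrans τ.obj τ.property) X).map t := by
  -- Naturality in `t` is the modification axiom at the vertical morphism `(1, t)`, whiskered with
  -- the image of `underVert T`.
  have h := congrArg (fun η => F.map (underVert T) ◁ η)
    (OplaxCone.homApp_naturality Γ.hom (vert (a := X.base) t.right))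
  have h₁ := coneCell_cosliceSection_heq (.ofTrans σ.obj σ.property) t
  have h₂ := coneCell_cosliceSection_heq (.ofTrans τ.obj τ.property) t
  have e : ∀ w : WeightedCocone (cosliceWeight Z) F U, (w.fn X).obj T' =
      F.map (underVert T) ≫ F.map (vert (a := X.base) t.right) ≫
        (w.fn ⟨X.base, T'.right⟩).obj (Under.mk (𝟙 T'.right)) := fun w =>
    (cosliceSection_fn_obj w T').trans (by
      rw [← underVert_comp t]
      exact (comp_map_obj F _ _ _).symm)
  have h₃ : cosliceHomApp Γ T' ≍ F.map (underVert T) ◁ F.map (vert (a := X.base) t.right) ◁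
      OplaxCone.homApp Γ.hom ⟨X.base, T'.right⟩ := by
    refine (cosliceHomApp_heq Γ T').trans (HEq.trans ?_ (comp_map_heq F _ _ _).symm)
    rw [underVert_comp t]
  apply eq_of_heq
  refine (comp_heq (cosliceSection_fn_obj _ T) (e _) (e _) h₁.symm h₃).trans ?_
  refine HEq.trans ?_ (comp_heq (cosliceSection_fn_obj _ T) (cosliceSection_fn_obj _ T) (e _)
    (cosliceHomApp_heq Γ T) h₂.symm).symm
  exact (heq_of_eq (Bicategory.whiskerLeft_comp _ _ _).symm).trans ((heq_of_eq h.symm).trans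
    (heq_of_eq (Bicategory.whiskerLeft_comp _ _ _)))

/-- The component over `(cosliceMap p).obj T` sits at a cartesian source, so `homApp_cart_heq` moves
it along `(p.base, 1)`; `vert_comp_cart` then trades the composite for `p` followed by `underVert
T`. -/
lemma cosliceHomApp_map {X Y : Elements Z} (p : X ⟶ Y) (T : Under Y.fiber) :
    cosliceHomApp Γ ((cosliceMap p).obj T) ≍ F.map p ◁ cosliceHomApp Γ T := by
  have hσ := OplaxCone.isIdCell_cell_cart
    (((cosliceSection Z).functor cosliceSection_marked F U).obj σ) p.base T.right
  have hτ := OplaxCone.isIdCell_cell_cart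
    (((cosliceSection Z).functor cosliceSection_marked F U).obj τ) p.base T.right
  refine (cosliceHomApp_heq Γ ((cosliceMap p).obj T)).trans ((whiskerLeft_heq rfl hσ.1 hτ.1
    (OplaxCone.homApp_cart_heq Γ p.base T.right)).trans ((comp_map_heq F _ _ _).trans ?_))
  refine HEq.trans ?_ (whiskerLeft_heq rfl (cosliceSection_fn_obj _ T) (cosliceSection_fn_obj _ T)
    (cosliceHomApp_heq Γ T)).symm
  refine HEq.trans ?_ (comp_map_heq F _ _ _).symm
  exact whiskerLeft_heq (congrArg F.map (vert_comp_cart p T.hom)) rfl rfl HEq.rfl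

end

variable (Z F U) in
/-- The functor from weighted cocones to marked oplax cones is fully faithful. -/
noncomputable def cosliceSectionFullyFaithful :
    ((cosliceSection Z).functor cosliceSection_marked F U).FullyFaithful where
  preimage {σ τ} Γ := ObjectProperty.homMk (WeightedCocone.homMk σ.property τ.property
    (fun X =>
      { app := fun T => cosliceHomApp Γ T
        naturality := fun T T' t => cosliceHomApp_naturality Γ t })
    (fun p T => cosliceHomApp_map Γ p T))
  map_preimage {σ τ} Γ := ObjectProperty.hom_ext _ (OplaxCone.hom_ext fun X => eq_of_heq
    ((cosliceHomApp_heq Γ (Under.mk (𝟙 X.fiber))).trans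
      ((whiskerLeft_heq (congrArg F.map (vert_id X.fiber)) rfl rfl HEq.rfl).trans (id_map_heq F _))))
  -- A modification is recovered at `T` from its component at an identity, by its compatibility with
  -- the action of `underVert T`.
  preimage_map {σ τ} Γ := ObjectProperty.hom_ext _ (Oplax.OplaxTrans.homCategory.ext fun X =>
    Cat.Hom₂.ext (NatTrans.ext (funext fun (T : Under X.unop.fiber) => eq_of_heq
      ((cosliceHomApp_heq _ T).trans
        ((WeightedCocone.hom_app_map σ.property τ.property Γ.hom (underVert T)
          (Under.mk (𝟙 T.right))).symm.trans
          (natTrans_app_heq (Γ.hom.as.app X).toNatTrans (cosliceMap_underVert_obj T)))))))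

variable (Z F) in
/-- Cocones weighted by the coslices and cartesian-marked oplax cones agree. -/
noncomputable def cosliceIsoMarked :
    CoconesIso ⊤ (cosliceWeight Z) F (cartesianMarking Z) (constOne _)
      ((StrictPseudofunctor.id _).comp F) :=
  (cosliceSection Z).coconesIso cosliceSection_marked F (cosliceSectionFullyFaithful Z F)
    cosliceSection_functor_injective cosliceSection_functor_surjective

end

end OplaxColim

theorem mainTheorem10 {A : Type u} [Bicategory.{u, u} A] [Bicategory.Strict A]
    {C : Type u₁} [Bicategory.{u, u} C] [Bicategory.Strict C] :
    (∀ (W : StrictPseudofunctor Aᵒᵖ Cat.{u, u}) (F : StrictPseudofunctor A C),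
      (∀ L : C, OplaxColim.IsWeightedColimit W F L ↔
        OplaxColim.IsOplaxConicalColimit ((OplaxColim.Elements.proj W).comp F) L) ∧
      (∀ L L' : C, OplaxColim.IsWeightedColimit W F L →
        OplaxColim.IsOplaxConicalColimit ((OplaxColim.Elements.proj W).comp F) L' →
        Nonempty (L ≅ L'))) ∧
    (∀ (Z : StrictPseudofunctor Aᵒᵖ Cat.{u, u})
      (F : StrictPseudofunctor (OplaxColim.Elements Z) C),
      (∀ L : C, OplaxColim.IsOplaxConicalColimit F L ↔
        OplaxColim.IsWeightedColimit (OplaxColim.cosliceWeight Z) F L) ∧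
      (∀ L L' : C, OplaxColim.IsOplaxConicalColimit F L →
        OplaxColim.IsWeightedColimit (OplaxColim.cosliceWeight Z) F L' →
        Nonempty (L ≅ L'))) := by
  refine ⟨fun W F => ?_, fun Z F => ?_⟩
  · have h := (OplaxColim.weightedIsoMarked W F).nonempty_colimitData_iff
    exact ⟨h, fun L L' ⟨D⟩ hL' => let ⟨D'⟩ := (h L').2 hL'; D.nonempty_iso D'⟩
  · have h := (OplaxColim.cosliceIsoMarked Z F).nonempty_colimitData_iff
    -- The coslice section lies over the identity 2-functor, so its cones are over the composite of
    -- the identity with `F`, which is strictly equal to `F`.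
    rw [OplaxColim.id_comp_eq] at h
    exact ⟨fun L => (h L).symm, fun L L' ⟨D⟩ hL' => let ⟨D'⟩ := (h L').1 hL'; D.nonempty_iso D'⟩
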